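/- Let $\mathbb C((z^{-1}))$ be the field of formal Laurent series $\sum_{k\le n}a_kz^k$ over $\mathbb C$; a nonzero series has order $n$ if $z^n$ is its highest power with nonzero coefficient. For $m\ge 0$ let $S_m=\{-m,-m+2,\dots,m,m+1,m+2,\dots\}$, and let $\Sigma_m$ be the set of subspaces $W\subset\mathbb C((z^{-1}))$ with $z^2W\subset W$ such that the set of orders of nonzero elements of $W$ is $S_m$. A canonical basis of $W\in\Sigma_m$ is a family $p_s\in W$ $(s\in S_m)$ with $p_s=z^s+(\text{lower powers})$ in which the coefficient of $z^i$ vanishes for all $i\in S_m$ with $0\le i<s$. A subspace $V$ is called closed if $V\cdot V\subset V$. Let $I=\{3,5,6,7,\dots\}$. (1) (Maximality.) Let $W\in\Sigma_5$. Every nonzero element of a closed subspace $V\subset W$ has order in $I$. If $(p_s)$ is a canonical basis of $W$ and $T\subset S_5$ is such that $\langle p_s\rangle_{s\in T}$ is closed, then $T\subset I$; and if $\langle p_s\rangle_{s\in I}$ is closed, it is maximal among the closed subspaces of $W$. (2) (Closedness.) Let $p_j=z^j+H^j_{-4}z^4+H^j_{-2}z^2+H^j_0+\sum_{k\ge1}H^j_kz^{-k}$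 for $j\in I$, with complex coefficients $H^j_k$ and $H^3_{-4}=0$. Then all products $p_jp_k$ are finite sums $\sum_{l\in I}C_{jk}^lp_l$ $(j,k\in I)$ and $z^2\langle p_i\rangle_{i\in I}\subset\langle p_i\rangle_{i\in I}$ if and only if $H^j_k=0$ for all $j\in I$, $k\ge1$ (so all $p_j$ are polynomials) and $$H^5_0=0,\quad H^5_{-2}=H^3_0,\quad H^5_{-4}=H^3_{-2},\qquad H^6_0=-(H^3_0)^2,\quad H^6_{-2}=-2H^3_0H^3_{-2},\quad H^6_{-4}=-(H^3_{-2})^2,$$ $$H^{j+2}_{-4}=H^j_{-2}-H^j_{-4}H^6_{-4},\quad H^{j+2}_{-2}=H^j_0-H^j_{-4}H^6_{-2},\quad H^{j+2}_0=-H^j_{-4}H^6_0\qquad(j\in I).\tag{$*$}$$ In that case, for $j,k,l\in I$, $$C_{jk}^l=\delta_{j+k}^l+\sum_{s=0}^2H^j_{-2s}\delta^l_{2s+k}+\sum_{s=0}^2H^k_{-2s}\delta^l_{2s+j}+\sum_{s,r=0}^2H^j_{-2s}H^k_{-2r}\delta^l_{2(r+s)}.\tag{$**$}$$ For all $a,b\in\mathbb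 C$ there is exactly one solution of $(*)$ (with $H^3_{-4}=0$) such that $H^3_{-2}=a$, $H^3_0=b$. (3) (The family $W_5$.) Let $W_5$ be the set of closed subspaces $U$ with $z^2U\subset U$ of the form $U=\langle p_s\rangle_{s\in I}$, where $(p_s)$ is a canonical basis of some $W\in\Sigma_5$. Then $U\in W_5$ if and only if there is a (then unique) solution $H=(H^j_{-4},H^j_{-2},H^j_0)_{j\in I}$ of $(*)$ with $H^3_{-4}=0$ such that $U$ is spanned by the polynomials $p_j=z^j+H^j_{-4}z^4+H^j_{-2}z^2+H^j_0$, $j\in I$. For every such $H$ these $p_j$ are a basis of an infinite-dimensional commutative associative (non-unital) subalgebra $A_5\subset\mathbb C[z]$ with structure constants $(**)$, and the kernel of $\mathbb C[P_j:j\in I]\to\mathbb C[z]$, $P_j\mapsto p_j(z)$, is the ideal generated by the quadrics $P_jP_k-\sum_{l\in I}C_{jk}^lP_l$. (4) (Curves.) Let $\Gamma_5$ be the variety in the affine space with coordinates $p_j$, $H^j_{-4},H^j_{-2},H^j_0$ $(j\in I)$ defined by $H^3_{-4}=0$, by $(*)$ and by $p_jp_k=\sum_{l\in I}C_{jk}^lp_l$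 with $(**)$. With $a=H^3_{-2}$, $b=H^3_0$, the ideal generated by these equations contains $$p_5^3-p_3^5+2ap_3^3p_5-a^2p_3p_5^2+2bp_3^4-2abp_3^2p_5-b^2p_3^3$$ and $$\begin{aligned}&p_6^5-p_5^6+6ap_5p_6^4+14a^2p_5^2p_6^3+(6b+16a^3)p_5^3p_6^2+(16ab+9a^4)p_5^4p_6+(10a^2b+2a^5)p_5^5+2b^2p_6^4\\&+8ab^2p_5p_6^3+10a^2b^2p_5^2p_6^2+(14b^3+4a^3b^2)p_5^3p_6+20ab^3p_5^4+b^4p_6^3+2ab^4p_5p_6^2+8b^5p_5^3.\end{aligned}$$ For all $a,b\in\mathbb C$ these two polynomials, in the two variables $p_3,p_5$ and $p_5,p_6$ respectively, define irreducible rational plane curves (with function field isomorphic to $\mathbb C(t)$), of geometric genus $0$. -/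

import Mathlib

open scoped Polynomial

noncomputable section

namespace BirkhoffFive

/-! ### Formal Laurent series in `z⁻¹` and the Birkhoff strata of `Gr⁽²⁾`

`LaurentSeries ℂ` is used with the local parameter `z⁻¹`: the coefficient of `z ^ n` in `f`
is `f.coeff (-n)`, so that every series has finitely many positive powers of `z`. -/

/-- The element `z`. -/
def z : LaurentSeries ℂ := HahnSeries.single (-1) 1

/-- The coefficient of `z ^ n`. -/
def zcoeff (f : LaurentSeries ℂ) (n : ℤ) : ℂ := f.coeff (-n)

/-- `f` has order `n` in `z`: its leading term is a nonzero multiple of `z ^ n`. -/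
def HasOrder (f : LaurentSeries ℂ) (n : ℤ) : Prop :=
  zcoeff f n ≠ 0 ∧ ∀ m : ℤ, n < m → zcoeff f m = 0

/-- `S_m = {-m, -m + 2, …, m, m + 1, m + 2, …}`. -/
def stratumIndex (m : ℕ) : Set ℤ :=
  {s | (m : ℤ) ≤ s ∨ (-(m : ℤ) ≤ s ∧ s ≤ m ∧ Even (s + m))}

/-- `z² V ⊆ V`. -/
def SqInvariant (V : Submodule ℂ (LaurentSeries ℂ)) : Prop :=
  ∀ f ∈ V, z ^ 2 * f ∈ V

/-- `V · V ⊆ V`. -/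
def MulClosed (V : Submodule ℂ (LaurentSeries ℂ)) : Prop :=
  ∀ f ∈ V, ∀ g ∈ V, f * g ∈ V

/-- The stratum `Σ_m` of `Gr⁽²⁾`: the subspaces `W` with `z² W ⊆ W` whose nonzero elements have
exactly the orders in `S_m`. (As `S_m` is bounded below, such a `W` is the span of
any choice of elements `w_s ∈ W` of order `s`, `s ∈ S_m`.) -/
def stratum (m : ℕ) : Set (Submodule ℂ (LaurentSeries ℂ)) :=
  {W | SqInvariant W ∧ {n : ℤ | ∃ f ∈ W, HasOrder f n} = stratumIndex m}

/-- `(p_s)_{s ∈ S_m}` is a canonical basis of the point `W` of `Σ_m`: `p_s ∈ W` is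
`z ^ s` plus lower powers, and its nonnegative powers `z ^ i`, `i < s`, have `i ∉ S_m`.
(The negative powers are left free.) -/
def IsCanonicalBasis (m : ℕ) (W : Submodule ℂ (LaurentSeries ℂ)) (p : ℤ → LaurentSeries ℂ) :
    Prop :=
  ∀ s ∈ stratumIndex m, p s ∈ W ∧ zcoeff (p s) s = 1 ∧ (∀ n : ℤ, s < n → zcoeff (p s) n = 0) ∧
    ∀ i ∈ stratumIndex m, 0 ≤ i → i < s → zcoeff (p s) i = 0

/-- The orders `3, 5, 6, 7, …` as integers. -/
def closedOrders : Set ℤ := {n | n = 3 ∨ 5 ≤ n}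

/-- The family `W_5`: all subspaces `⟨p_3, p_5, p_6, …⟩` spanned by members of a canonical basis of
a point of `Σ_5` that are closed under multiplication and under `z²`. -/
def W5 : Set (Submodule ℂ (LaurentSeries ℂ)) :=
  {U | MulClosed U ∧ SqInvariant U ∧ ∃ W ∈ stratum 5, ∃ p : ℤ → LaurentSeries ℂ,
    IsCanonicalBasis 5 W p ∧ U = Submodule.span ℂ (p '' closedOrders)}

/-! ### The series `p_3, p_5, p_6, …`, the constraints and the structure constants -/

/-- The index set `3, 5, 6, 7, …`. -/
abbrev Idx : Type := {j : ℕ // j = 3 ∨ 5 ≤ j}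

def i3 : Idx := ⟨3, Or.inl rfl⟩
def i5 : Idx := ⟨5, Or.inr le_rfl⟩
def i6 : Idx := ⟨6, Or.inr (by norm_num)⟩

/-- The index `j + 2`. -/
def Idx.addTwo (j : Idx) : Idx := ⟨j.1 + 2, by have := j.2; omega⟩

/-- `p_j = z^j + H^j_{-4} z^4 + H^j_{-2} z^2 + H^j_0 + ∑_{k ≥ 1} H^j_k z^{-k}`, with
`H j k = H^j_k`. (For `j = 3` the convention is `H^3_{-4} = 0`.) -/
def series (H : Idx → ℤ → ℂ) (j : Idx) : LaurentSeries ℂ :=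
  z ^ (j : ℕ) + H j (-4) • z ^ 4 + H j (-2) • z ^ 2 + H j 0 • 1 +
    HahnSeries.ofPowerSeries ℤ ℂ (PowerSeries.mk fun k : ℕ => if k = 0 then 0 else H j k)

/-- The coefficients of the nonnegative powers: `evenPart H j s = H^j_{-2s}`, `s = 0, 1, 2`. -/
def evenPart (H : Idx → ℤ → ℂ) (j : Idx) (s : Fin 3) : ℂ := H j (-2 * ((s : ℕ) : ℤ))

/-- The quantities in `E j s = H^j_{-2s}` whose vanishing is the set of constraints. -/
def constraintSet {R : Type*} [CommRing R] (E : Idx → Fin 3 → R) : Set R :=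
  {E i3 2} ∪
  {E i5 0, E i5 1 - E i3 0, E i5 2 - E i3 1} ∪
  {E i6 0 + E i3 0 ^ 2, E i6 1 + 2 * E i3 0 * E i3 1, E i6 2 + E i3 1 ^ 2} ∪
  ⋃ j : Idx, {E j.addTwo 2 + E j 2 * E i6 2 - E j 1, E j.addTwo 1 + E j 2 * E i6 1 - E j 0,
    E j.addTwo 0 + E j 2 * E i6 0}

/-- The constraints on `E j s = H^j_{-2s}`. -/
def Constraints {R : Type*} [CommRing R] (E : Idx → Fin 3 → R) : Prop :=
  ∀ x ∈ constraintSet E, x = 0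

/-- The structure constants
`C_{jk}^l = δ_{j+k}^l + ∑_s H^j_{-2s} δ^l_{2s+k} + ∑_s H^k_{-2s} δ^l_{2s+j}
  + ∑_{s,r} H^j_{-2s} H^k_{-2r} δ^l_{2(r+s)}`. -/
def structConst {R : Type*} [CommRing R] (E : Idx → Fin 3 → R) (j k l : Idx) : R :=
  (if (l : ℕ) = j + k then 1 else 0) +
  (∑ s : Fin 3, if (l : ℕ) = 2 * s + k then E j s else 0) +
  (∑ s : Fin 3, if (l : ℕ) = 2 * s + j then E k s else 0) +
  ∑ s : Fin 3, ∑ r : Fin 3, if (l : ℕ) = 2 * (r + s) then E j s * E k r else 0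

/-- The polynomial `z^j + H^j_{-4} z^4 + H^j_{-2} z^2 + H^j_0`. -/
def basisPoly (E : Idx → Fin 3 → ℂ) (j : Idx) : ℂ[X] :=
  Polynomial.X ^ (j : ℕ) + ∑ s : Fin 3, Polynomial.C (E j s) * Polynomial.X ^ (2 * (s : ℕ))

/-- The inclusion of the polynomials in `z` in the Laurent series. -/
def polyToLaurent : ℂ[X] →ₐ[ℂ] LaurentSeries ℂ := Polynomial.aeval z

/-! ### The variety `Γ_5` -/

/-- Indices `l ≤ n`. -/
def idxUpTo (n : ℕ) : Finset Idx := (Finset.range (n + 1)).subtype (fun j => j = 3 ∨ 5 ≤ j)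

/-- `P_j P_k - ∑_l C_{jk}^l P_l`; the structure constants vanish for `l > j + k + 2`. -/
def quadric {R : Type*} [CommRing R] (E : Idx → Fin 3 → R) (P : Idx → R) (j k : Idx) : R :=
  P j * P k - ∑ l ∈ idxUpTo (j + k + 2), structConst E j k l * P l

/-- The affine coordinates `p_j` and `H^j_{-2s}`. -/
inductive Coord : Type
  | p (j : Idx)
  | h (j : Idx) (s : Fin 3)

def pVar (j : Idx) : MvPolynomial Coord ℂ := MvPolynomial.X (Coord.p j)

def hVar (j : Idx) (s : Fin 3) : MvPolynomial Coord ℂ := MvPolynomial.X (Coord.h j s)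

/-- The ideal of the equations of `Γ_5` in the affine space with coordinates `p_j`, `H^j_{-2s}`. -/
def gammaIdeal : Ideal (MvPolynomial Coord ℂ) :=
  Ideal.span (constraintSet hVar ∪ {q | ∃ j k : Idx, q = quadric hVar pVar j k})

/-- The fibre of that ideal over fixed values of the `H^j_{-2s}`. -/
def fibreIdeal (E : Idx → Fin 3 → ℂ) : Ideal (MvPolynomial Idx ℂ) :=
  Ideal.span {q | ∃ j k : Idx,
    q = quadric (fun i s => MvPolynomial.C (E i s)) MvPolynomial.X j k}

/-- The left side of the equation of the `(3,5)` curve; `a = H^3_{-2}`, `b = H^3_0`. -/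
def curve35 {R : Type*} [CommRing R] (a b p3 p5 : R) : R :=
  p5 ^ 3 - p3 ^ 5 + 2 * a * p3 ^ 3 * p5 - a ^ 2 * p3 * p5 ^ 2 + 2 * b * p3 ^ 4
    - 2 * b * a * p3 ^ 2 * p5 - b ^ 2 * p3 ^ 3

/-- The left side of the equation of the `(5,6)` curve; `a = H^3_{-2}`, `b = H^3_0`. -/
def curve56 {R : Type*} [CommRing R] (a b p5 p6 : R) : R :=
  p6 ^ 5 - p5 ^ 6 + 6 * a * p5 * p6 ^ 4 + 14 * a ^ 2 * p5 ^ 2 * p6 ^ 3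
    - (-6 * b - 16 * a ^ 3) * p5 ^ 3 * p6 ^ 2
    - (-16 * b * a - 9 * a ^ 4) * p5 ^ 4 * p6
    - (-10 * b * a ^ 2 - 2 * a ^ 5) * p5 ^ 5
    + 2 * b ^ 2 * p6 ^ 4 + 8 * b ^ 2 * a * p5 * p6 ^ 3 + 10 * a ^ 2 * b ^ 2 * p5 ^ 2 * p6 ^ 2
    - (-14 * b ^ 3 - 4 * a ^ 3 * b ^ 2) * p5 ^ 3 * p6
    + 20 * b ^ 3 * a * p5 ^ 4 + b ^ 4 * p6 ^ 3 + 2 * b ^ 4 * a * p5 * p6 ^ 2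
    + 8 * b ^ 5 * p5 ^ 3

/-! ### Plane curves and their genus -/

/-- The `(3,5)` curve as a polynomial in the two coordinates of the plane. -/
def plane35 (a b : ℂ) : MvPolynomial (Fin 2) ℂ :=
  curve35 (MvPolynomial.C a) (MvPolynomial.C b) (MvPolynomial.X 0) (MvPolynomial.X 1)

/-- The `(5,6)` curve as a polynomial in the two coordinates of the plane. -/
def plane56 (a b : ℂ) : MvPolynomial (Fin 2) ℂ :=
  curve56 (MvPolynomial.C a) (MvPolynomial.C b) (MvPolynomial.X 0) (MvPolynomial.X 1)

/-- The everywhere regular differentials of a function field `F` over `k`: those `ω ∈ Ω_{F/k}`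
that lie in `A · dA` for every valuation ring `A` of `F` containing `k`. -/
def regularDifferentials (k F : Type*) [Field k] [Field F] [Algebra k F] :
    Submodule k (Ω[F⁄k]) where
  carrier := {ω | ∀ A : ValuationSubring F, (∀ c : k, algebraMap k F c ∈ A) →
    ω ∈ Submodule.span A.toSubring (Set.range fun x : A => KaehlerDifferential.D k F (x : F))}
  add_mem' h₁ h₂ A hA := Submodule.add_mem _ (h₁ A hA) (h₂ A hA)
  zero_mem' A hA := Submodule.zero_mem _
  smul_mem' c ω h A hA := by
    have h2 := Submodule.smul_mem _ (⟨algebraMap k F c, hA c⟩ : A.toSubring) (h A hA)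
    have h3 : (⟨algebraMap k F c, hA c⟩ : A.toSubring) • ω = c • ω :=
      algebraMap_smul F c ω
    rwa [h3] at h2

/-- The coordinate ring of the plane curve `f = 0`. -/
abbrev CoordRing (f : MvPolynomial (Fin 2) ℂ) : Type :=
  MvPolynomial (Fin 2) ℂ ⧸ Ideal.span {f}

/-- The plane curve `f = 0` is integral and has geometric genus `g`: the space of regular
differentials of its function field (the global differentials on its smooth projective model)
has dimension `g`. -/
def HasGenus (f : MvPolynomial (Fin 2) ℂ) (g : ℕ) : Prop :=
  ∃ _ : IsDomain (CoordRing f),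
    Module.rank ℂ (regularDifferentials ℂ (FractionRing (CoordRing f))) = g

/-- The plane curve `f = 0` is irreducible and rational: its function field is `ℂ(t)`. -/
def IsRationalCurve (f : MvPolynomial (Fin 2) ℂ) : Prop :=
  Irreducible f ∧ Nonempty (FractionRing (CoordRing f) ≃ₐ[ℂ] RatFunc ℂ)

end BirkhoffFive

end

open scoped Polynomial

noncomputable section

namespace BirkhoffFive

/-! ### The constraints and the polynomials `z^j + H^j_{-4} z^4 + H^j_{-2} z^2 + H^j_0` -/

/-! Put e = az² + b. The constraints say that p_3 = z³ + e, p_6 = z⁶ - e² and p_{j+2} = z² p_j -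
H^j_{-4} p_6, so the span is ℂ[z²] p_3 ⊕ ℂ[z²] p_6. It is closed because p_6 is a polynomial in z²
and p_3² = p_6 + 2e p_3 (`genPoly_mul_mem`). An element of the span is determined by its
coefficients at 3, 5, 6, …, and this turns memberships into formulas throughout.

Conversely, no element of the span of the series contains z, and invariance under z² then excludes
all lower odd powers. Hence p_3 - z³ is even and the odd part of p_3² is 2z³(p_3 - z³). As that part
has no powers below z³, p_3 is a polynomial; p_5, p_6 and all other p_j follow
(`zcoeff_neg_eq_zero`), and comparing coefficients gives the constraints (`constraints_evenPart`).

Maximality holds because an order n in a closed subspace has n and 2n in S_5. A point of W_5 is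
realized in Σ_5 by adjoining z⁻²p_3, …, z⁻⁸p_3 (`laurentSpan_mem_W5`).

For the relations, the linear map z^l ↦ P_l is multiplicative on the span as soon as the quadrics
vanish, so every relation between the p_j follows from them (`aeval_eq_zero_of_genPoly`). This works
over any base ring; over the quotient by the ideal of Γ_5 it reduces the two plane equations to
identities in z.

Each plane curve has a polynomial parametrization of coprime degrees, whose kernel is generated by
the equation (`ker_parametrization`). The parameter t is a rational function of the two coordinates,
so the function field is ℂ(t), which has no nonzero regular differentials
(`regularDifferentials_eq_bot`). -/

theorem Idx.addTwo_val (j : Idx) : (j.addTwo : ℕ) = j + 2 := rfl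

theorem addTwo_i3 : i3.addTwo = i5 := rfl

/-- Induction on `3, 5, 6, 7, …` in steps of two. -/
theorem Idx.induction_addTwo {motive : Idx → Prop} (three : motive i3) (six : motive i6)
    (addTwo : ∀ j, motive j → motive j.addTwo) (j : Idx) : motive j := by
  obtain ⟨n, hn⟩ := j
  induction n using Nat.strong_induction_on with
  | _ n ih =>
    by_cases h3 : n = 3
    · subst h3; exact three
    by_cases h6 : n = 6
    · subst h6; exact six
    have h : n - 2 = 3 ∨ 5 ≤ n - 2 := by omega
    have h2 := addTwo _ (ih (n - 2) (by omega) h)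
    have h3 : Idx.addTwo ⟨n - 2, h⟩ = ⟨n, hn⟩ := Subtype.ext (by simp only [Idx.addTwo]; omega)
    rwa [h3] at h2

section General

variable {R : Type*} [CommRing R]

theorem constraints_iff (E : Idx → Fin 3 → R) :
    Constraints E ↔ E i3 2 = 0 ∧ (E i5 0 = 0 ∧ E i5 1 = E i3 0 ∧ E i5 2 = E i3 1) ∧
      (E i6 0 = -E i3 0 ^ 2 ∧ E i6 1 = -(2 * E i3 0 * E i3 1) ∧ E i6 2 = -E i3 1 ^ 2) ∧
      ∀ j : Idx, E j.addTwo 2 = E j 1 - E j 2 * E i6 2 ∧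
        E j.addTwo 1 = E j 0 - E j 2 * E i6 1 ∧ E j.addTwo 0 = -(E j 2 * E i6 0) := by
  constructor
  · intro h
    refine ⟨h _ (by simp [constraintSet]), ⟨h _ (by simp [constraintSet]), ?_, ?_⟩,
      ⟨?_, ?_, ?_⟩, fun j => ⟨?_, ?_, ?_⟩⟩
    · exact sub_eq_zero.1 (h _ (by simp [constraintSet]))
    · exact sub_eq_zero.1 (h _ (by simp [constraintSet]))
    · exact eq_neg_of_add_eq_zero_left (h _ (by simp [constraintSet]))
    · exact eq_neg_of_add_eq_zero_left (h _ (by simp [constraintSet]))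
    · exact eq_neg_of_add_eq_zero_left (h _ (by simp [constraintSet]))
    · have := h (E j.addTwo 2 + E j 2 * E i6 2 - E j 1)
        (Or.inr (Set.mem_iUnion.2 ⟨j, by simp⟩))
      linear_combination this
    · have := h (E j.addTwo 1 + E j 2 * E i6 1 - E j 0)
        (Or.inr (Set.mem_iUnion.2 ⟨j, by simp⟩))
      linear_combination this
    · have := h (E j.addTwo 0 + E j 2 * E i6 0)
        (Or.inr (Set.mem_iUnion.2 ⟨j, by simp⟩))
      linear_combination this
  · rintro ⟨h3, ⟨h50, h51, h52⟩, ⟨h60, h61, h62⟩, hj⟩ x hx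
    simp only [constraintSet, Set.mem_union, Set.mem_singleton_iff, Set.mem_insert_iff,
      Set.mem_iUnion] at hx
    rcases hx with ((rfl | rfl | rfl | rfl) | rfl | rfl | rfl) | ⟨j, rfl | rfl | rfl⟩
    · exact h3
    · exact h50
    · rw [h51, sub_self]
    · rw [h52, sub_self]
    · rw [h60]; ring
    · rw [h61]; ring
    · rw [h62]; ring
    · rw [(hj j).1]; ring
    · rw [(hj j).2.1]; ring
    · rw [(hj j).2.2]; ring

/-- `z^j + H^j_{-4} z^4 + H^j_{-2} z^2 + H^j_0` over any ring. -/
def genPoly (E : Idx → Fin 3 → R) (j : Idx) : R[X] :=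
  Polynomial.X ^ (j : ℕ) + ∑ s : Fin 3, Polynomial.C (E j s) * Polynomial.X ^ (2 * (s : ℕ))

theorem basisPoly_eq_genPoly (E : Idx → Fin 3 → ℂ) : basisPoly E = genPoly E := rfl

open Polynomial in
theorem genPoly_eq (E : Idx → Fin 3 → R) (j : Idx) :
    genPoly E j = X ^ (j : ℕ) + C (E j 2) * X ^ 4 + C (E j 1) * X ^ 2 + C (E j 0) := by
  simp [genPoly, Fin.sum_univ_three]; ring

theorem Idx.ne_two_mul (l : Idx) (s : Fin 3) : (l : ℕ) ≠ 2 * (s : ℕ) := by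
  have := l.2; omega

/-- The coefficients at the orders `3, 5, 6, …` are those of the basis vector. -/
theorem coeff_genPoly (E : Idx → Fin 3 → R) (j l : Idx) :
    (genPoly E j).coeff l = if l = j then 1 else 0 := by
  simp [genPoly, Polynomial.coeff_X_pow, l.ne_two_mul, Subtype.ext_iff]

theorem coeff_genPoly_even (E : Idx → Fin 3 → R) (j : Idx) (s : Fin 3) :
    (genPoly E j).coeff (2 * s) = E j s := by
  have h : ∀ r : Fin 3, (2 * (s : ℕ) = 2 * (r : ℕ)) ↔ r = s := fun r => by
    rw [Fin.ext_iff]; omega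
  simp [genPoly, Polynomial.coeff_X_pow, (j.ne_two_mul s).symm, h]

/-- The structure constants are coefficients of the products. -/
theorem coeff_genPoly_mul (E : Idx → Fin 3 → R) (j k l : Idx) :
    (genPoly E j * genPoly E k).coeff l = structConst E j k l := by
  have h : genPoly E j * genPoly E k = Polynomial.X ^ (j + k : ℕ) +
      ∑ s : Fin 3, Polynomial.C (E j s) * Polynomial.X ^ (2 * (s : ℕ) + k) +
      ∑ s : Fin 3, Polynomial.C (E k s) * Polynomial.X ^ (2 * (s : ℕ) + j) +
      ∑ s : Fin 3, ∑ r : Fin 3,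
        Polynomial.C (E j s * E k r) * Polynomial.X ^ (2 * ((r : ℕ) + s)) := by
    simp only [genPoly, Fin.sum_univ_three, map_mul, pow_add, mul_add]
    ring
  rw [h]
  simp only [structConst, Polynomial.coeff_add, Polynomial.finsetSum_coeff,
    Polynomial.coeff_C_mul, Polynomial.coeff_X_pow, mul_ite, mul_one, mul_zero]

/-- The span of the polynomials. -/
def polySpan (E : Idx → Fin 3 → R) : Submodule R R[X] :=
  Submodule.span R (Set.range (genPoly E))

theorem genPoly_mem (E : Idx → Fin 3 → R) (j : Idx) : genPoly E j ∈ polySpan E :=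
  Submodule.subset_span ⟨j, rfl⟩

theorem coeff_linearCombination_genPoly (E : Idx → Fin 3 → R) (c : Idx →₀ R) (l : Idx) :
    (Finsupp.linearCombination R (genPoly E) c).coeff l = c l := by
  rw [Finsupp.linearCombination_apply, Finsupp.sum, Polynomial.finsetSum_coeff]
  simp only [Polynomial.coeff_smul, coeff_genPoly, smul_eq_mul, mul_ite, mul_one, mul_zero]
  rw [Finset.sum_ite_eq]
  split_ifs with h
  · rfl
  · exact (Finsupp.notMem_support_iff.1 h).symm

/-- An element of the span is determined by its coefficients at `3, 5, 6, …`. -/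
theorem polySpan_eq_of_coeff (E : Idx → Fin 3 → R) {f g : R[X]} (hf : f ∈ polySpan E)
    (hg : g ∈ polySpan E) (h : ∀ l : Idx, f.coeff l = g.coeff l) : f = g := by
  obtain ⟨c, rfl⟩ := (Finsupp.mem_span_range_iff_exists_finsupp).1 hf
  obtain ⟨d, rfl⟩ := (Finsupp.mem_span_range_iff_exists_finsupp).1 hg
  have hcd : c = d := by
    ext l
    have := h l
    rwa [← Finsupp.linearCombination_apply, ← Finsupp.linearCombination_apply,
      coeff_linearCombination_genPoly, coeff_linearCombination_genPoly] at this
  rw [hcd]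

/-! ### Closedness of the span of the polynomials. -/

section Closed

variable {E : Idx → Fin 3 → R}

open Polynomial in
theorem genPoly_i3 (hE : Constraints E) :
    genPoly E i3 = X ^ 3 + C (E i3 1) * X ^ 2 + C (E i3 0) := by
  rw [genPoly_eq, ((constraints_iff E).1 hE).1]; simp [i3]

open Polynomial in
-- The product z² p_j has the extra term H^j_{-4} z⁶, which p_6 removes; the recursive constraints
-- record what is left.
theorem genPoly_addTwo (hE : Constraints E) (j : Idx) :
    genPoly E j.addTwo = X ^ 2 * genPoly E j - C (E j 2) * genPoly E i6 := by
  obtain ⟨-, -, -, hj⟩ := (constraints_iff E).1 hE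
  obtain ⟨h2, h1, h0⟩ := hj j
  rw [genPoly_eq, genPoly_eq, genPoly_eq, h2, h1, h0, Idx.addTwo_val]
  simp only [i6, map_sub, map_mul, map_neg]
  ring

open Polynomial in
theorem genPoly_i5 (hE : Constraints E) : genPoly E i5 = X ^ 2 * genPoly E i3 := by
  rw [← addTwo_i3, genPoly_addTwo hE, ((constraints_iff E).1 hE).1]; simp

open Polynomial in
theorem genPoly_i6 (hE : Constraints E) :
    genPoly E i6 = X ^ 6 - (C (E i3 1) * X ^ 2 + C (E i3 0)) ^ 2 := by
  obtain ⟨-, -, ⟨h0, h1, h2⟩, -⟩ := (constraints_iff E).1 hE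
  rw [genPoly_eq, h0, h1, h2]
  simp only [i6, map_mul, map_neg, map_pow, map_ofNat]
  ring

open Polynomial in
theorem polySpan_sq (hE : Constraints E) {f : R[X]} (hf : f ∈ polySpan E) :
    X ^ 2 * f ∈ polySpan E := by
  induction hf using Submodule.span_induction with
  | mem x hx =>
    obtain ⟨j, rfl⟩ := hx
    have : X ^ 2 * genPoly E j = genPoly E j.addTwo + E j 2 • genPoly E i6 := by
      rw [genPoly_addTwo hE, smul_eq_C_mul]; ring
    rw [this]
    exact add_mem (genPoly_mem E _) (Submodule.smul_mem _ _ (genPoly_mem E _))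
  | zero => simp
  | add x y _ _ hx hy => rw [mul_add]; exact add_mem hx hy
  | smul c x _ hx => rw [mul_smul_comm]; exact Submodule.smul_mem _ _ hx

open Polynomial in
-- All p_j arise from p_3 and p_6 by multiplying by z² and subtracting multiples of p_6.
theorem polySpan_mul_genPoly (hE : Constraints E) {f : R[X]} (h3 : f * genPoly E i3 ∈ polySpan E)
    (h6 : f * genPoly E i6 ∈ polySpan E) (j : Idx) : f * genPoly E j ∈ polySpan E := by
  induction j using Idx.induction_addTwo with
  | three => exact h3
  | six => exact h6
  | addTwo j ih =>
    have : f * genPoly E j.addTwo = X ^ 2 * (f * genPoly E j) - E j 2 • (f * genPoly E i6) := by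
      rw [genPoly_addTwo hE, smul_eq_C_mul]; ring
    rw [this]
    exact sub_mem (polySpan_sq hE ih) (Submodule.smul_mem _ _ h6)

open Polynomial in
-- p_6 = z⁶ - (az² + b)² is a polynomial in z², and the span is stable under z².
theorem genPoly_i6_mul_mem (hE : Constraints E) {f : R[X]} (hf : f ∈ polySpan E) :
    genPoly E i6 * f ∈ polySpan E := by
  have h2 := polySpan_sq hE hf
  have h4 := polySpan_sq hE h2
  have h6 := polySpan_sq hE h4
  have : genPoly E i6 * f = X ^ 2 * (X ^ 2 * (X ^ 2 * f)) - ((E i3 1 ^ 2) • (X ^ 2 * (X ^ 2 * f))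
      + (2 * E i3 1 * E i3 0) • (X ^ 2 * f) + (E i3 0 ^ 2) • f) := by
    rw [genPoly_i6 hE]
    simp only [smul_eq_C_mul, map_mul, map_pow, map_ofNat]
    ring
  rw [this]
  exact sub_mem h6 (add_mem (add_mem (Submodule.smul_mem _ _ h4) (Submodule.smul_mem _ _ h2))
    (Submodule.smul_mem _ _ hf))

open Polynomial in
-- With e = az² + b this is (z³ + e)² = (z⁶ - e²) + 2e(z³ + e), where z² p_3 = p_5.
theorem genPoly_i3_sq (hE : Constraints E) : genPoly E i3 * genPoly E i3 =
    genPoly E i6 + (2 * E i3 1) • genPoly E i5 + (2 * E i3 0) • genPoly E i3 := by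
  rw [genPoly_i5 hE, genPoly_i6 hE, genPoly_i3 hE]
  simp only [smul_eq_C_mul, map_mul, map_ofNat]
  ring

theorem genPoly_mul_mem (hE : Constraints E) (j k : Idx) :
    genPoly E j * genPoly E k ∈ polySpan E := by
  have h6 : ∀ k, genPoly E i6 * genPoly E k ∈ polySpan E := fun k =>
    genPoly_i6_mul_mem hE (genPoly_mem E k)
  have h3 : ∀ k, genPoly E i3 * genPoly E k ∈ polySpan E := by
    refine polySpan_mul_genPoly hE ?_ ?_
    · rw [genPoly_i3_sq hE]
      exact add_mem (add_mem (genPoly_mem E _) (Submodule.smul_mem _ _ (genPoly_mem E _)))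
        (Submodule.smul_mem _ _ (genPoly_mem E _))
    · rw [mul_comm]; exact h6 _
  exact polySpan_mul_genPoly hE (by rw [mul_comm]; exact h3 _) (by rw [mul_comm]; exact h6 _) k

theorem polySpan_mul (hE : Constraints E) {f g : R[X]} (hf : f ∈ polySpan E)
    (hg : g ∈ polySpan E) : f * g ∈ polySpan E := by
  have h : polySpan E * polySpan E ≤ polySpan E := by
    rw [polySpan, Submodule.span_mul_span, Submodule.span_le]
    rintro _ ⟨_, ⟨j, rfl⟩, _, ⟨k, rfl⟩, rfl⟩
    exact genPoly_mul_mem hE j k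
  exact h (Submodule.mul_mem_mul hf hg)

end Closed

/-- The bound j + k + 2 is needed only for the last sum: 2(r + s) can be 8 while j + k can be 6. -/
theorem structConst_eq_zero (E : Idx → Fin 3 → R) {j k l : Idx} (h : (j + k + 2 : ℕ) < l) :
    structConst E j k l = 0 := by
  have hj : 3 ≤ (j : ℕ) := by have := j.2; omega
  have hk : 3 ≤ (k : ℕ) := by have := k.2; omega
  have h1 : (l : ℕ) ≠ j + k := by omega
  have h2 : ∀ s : Fin 3, (l : ℕ) ≠ 2 * s + k := fun s => by omega
  have h3 : ∀ s : Fin 3, (l : ℕ) ≠ 2 * s + j := fun s => by omega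
  have h4 : ∀ s r : Fin 3, (l : ℕ) ≠ 2 * (r + s) := fun s r => by omega
  simp [structConst, h1, h2, h3, h4]

theorem mem_idxUpTo {n : ℕ} {l : Idx} : l ∈ idxUpTo n ↔ (l : ℕ) ≤ n := by
  simp [idxUpTo]

theorem genPoly_mul_eq_sum {E : Idx → Fin 3 → R} (hE : Constraints E) (j k : Idx) :
    genPoly E j * genPoly E k =
      ∑ l ∈ idxUpTo (j + k + 2), structConst E j k l • genPoly E l := by
  refine polySpan_eq_of_coeff E (genPoly_mul_mem hE j k)
    (sum_mem fun l _ => Submodule.smul_mem _ _ (genPoly_mem E l)) fun l => ?_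
  rw [coeff_genPoly_mul, Polynomial.finsetSum_coeff]
  simp only [Polynomial.coeff_smul, coeff_genPoly, smul_eq_mul, mul_ite, mul_one, mul_zero]
  rw [Finset.sum_ite_eq]
  split_ifs with h
  · rfl
  · rw [mem_idxUpTo] at h
    exact structConst_eq_zero E (by omega)

end General

/-! ### Polynomial relations between the `p_j` -/

section Relations

variable {k : Type*} [CommRing k] {R : Type*} [CommRing R] [Algebra k R]

/-- The linear map with `z^l ↦ P_l` for `l = 3, 5, 6, …` and `z^l ↦ 0` otherwise. -/
def coordMap (P : Idx → R) : k[X] →ₗ[k] R :=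
  (Polynomial.basisMonomials k).constr k fun n : ℕ =>
    if h : n = 3 ∨ 5 ≤ n then P ⟨n, h⟩ else 0

theorem coordMap_X_pow (P : Idx → R) (n : ℕ) : coordMap (k := k) P (Polynomial.X ^ n) =
    if h : n = 3 ∨ 5 ≤ n then P ⟨n, h⟩ else 0 := by
  have h := Module.Basis.constr_basis (Polynomial.basisMonomials k) k
    (fun n : ℕ => if h : n = 3 ∨ 5 ≤ n then P ⟨n, h⟩ else 0) n
  rw [Polynomial.coe_basisMonomials] at h
  rwa [Polynomial.X_pow_eq_monomial]

theorem coordMap_C (P : Idx → R) (c : k) : coordMap P (Polynomial.C c) = 0 := by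
  have := coordMap_X_pow (k := k) P 0
  rw [← mul_one (Polynomial.C c), ← Polynomial.smul_eq_C_mul, map_smul, ← pow_zero Polynomial.X,
    this]
  simp

/-- The exponents 4, 2, 0 are not indices, so only the leading power survives. -/
theorem coordMap_genPoly (P : Idx → R) (E : Idx → Fin 3 → k) (j : Idx) :
    coordMap P (genPoly E j) = P j := by
  have h4 := coordMap_X_pow (k := k) P 4
  have h2 := coordMap_X_pow (k := k) P 2
  have hj := coordMap_X_pow (k := k) P j
  rw [dif_pos j.2] at hj
  rw [genPoly_eq, map_add, map_add, map_add, coordMap_C, ← Polynomial.smul_eq_C_mul,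
    ← Polynomial.smul_eq_C_mul, map_smul, map_smul, h4, h2, hj]
  simp

/-- The hypothesis that the quadrics vanish at `P`. -/
def QuadricsVanish (E : Idx → Fin 3 → k) (P : Idx → R) : Prop :=
  ∀ i j : Idx, quadric (fun l s => algebraMap k R (E l s)) P i j = 0

theorem algebraMap_structConst (E : Idx → Fin 3 → k) (i j l : Idx) :
    structConst (fun l s => algebraMap k R (E l s)) i j l =
      algebraMap k R (structConst E i j l) := by
  simp only [structConst, map_add, map_sum, apply_ite (algebraMap k R), map_one, map_zero, map_mul]

variable {E : Idx → Fin 3 → k} {P : Idx → R}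

/-- By bilinearity it suffices to take f = p_i and g = p_j, where the claim is the vanishing of one
quadric. -/
theorem coordMap_mul (hE : Constraints E) (hP : QuadricsVanish E P) {f g : k[X]}
    (hf : f ∈ polySpan E) (hg : g ∈ polySpan E) :
    coordMap P (f * g) = coordMap P f * coordMap P g := by
  induction hf using Submodule.span_induction with
  | zero => simp
  | add x y _ _ hx hy => rw [add_mul, map_add, map_add, hx, hy, add_mul]
  | smul c x _ hx => rw [smul_mul_assoc, map_smul, map_smul, hx, smul_mul_assoc]
  | mem x hx =>
    obtain ⟨i, rfl⟩ := hx
    induction hg using Submodule.span_induction with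
    | zero => simp
    | add x y _ _ hx hy => rw [mul_add, map_add, map_add, hx, hy, mul_add]
    | smul c x _ hx => rw [mul_smul_comm, map_smul, map_smul, hx, mul_smul_comm]
    | mem x hx =>
      obtain ⟨j, rfl⟩ := hx
      rw [genPoly_mul_eq_sum hE, map_sum, coordMap_genPoly, coordMap_genPoly,
        sub_eq_zero.1 (hP i j)]
      simp only [map_smul, coordMap_genPoly, algebraMap_structConst]
      simp only [Algebra.smul_def]

open MvPolynomial in
/-- Up to the constant term, evaluation at `P` factors over evaluation at the polynomials. -/
theorem coordMap_aeval (hE : Constraints E) (hP : QuadricsVanish E P) (f : MvPolynomial Idx k) :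
    aeval (genPoly E) f - Polynomial.C (constantCoeff f) ∈ polySpan E ∧
      coordMap P (aeval (genPoly E) f) = aeval P f - algebraMap k R (constantCoeff f) := by
  induction f using MvPolynomial.induction_on with
  | C c =>
    rw [aeval_C, aeval_C, constantCoeff_C, Polynomial.algebraMap_eq, coordMap_C]
    simp
  | add f g hf hg =>
    refine ⟨?_, ?_⟩
    · convert add_mem hf.1 hg.1 using 1
      simp only [map_add]; ring
    · simp only [map_add, hf.2, hg.2]; ring
  | mul_X f i hf =>
    -- `coordMap` is multiplicative only on the span, which contains no constants, so the constant
    -- term of f is split off first.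
    have h : aeval (genPoly E) (f * X i) =
        (aeval (genPoly E) f - Polynomial.C (constantCoeff f)) * genPoly E i +
          constantCoeff f • genPoly E i := by
      rw [map_mul, aeval_X, Polynomial.smul_eq_C_mul]; ring
    refine ⟨?_, ?_⟩
    · rw [h, map_mul, constantCoeff_X, mul_zero, map_zero, sub_zero]
      exact add_mem (polySpan_mul hE hf.1 (genPoly_mem E i))
        (Submodule.smul_mem _ _ (genPoly_mem E i))
    · rw [h, map_add, coordMap_mul hE hP hf.1 (genPoly_mem E i), map_smul, coordMap_genPoly,
        map_sub, coordMap_C, hf.2, map_mul, map_mul, constantCoeff_X, aeval_X, Algebra.smul_def]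
      simp only [mul_zero, map_zero]
      ring

/-- Every relation between the polynomials p_j holds wherever the quadrics vanish. -/
theorem aeval_eq_zero_of_genPoly (hE : Constraints E) (hP : QuadricsVanish E P)
    {f : MvPolynomial Idx k} (hf : MvPolynomial.aeval (genPoly E) f = 0) :
    MvPolynomial.aeval P f = 0 := by
  obtain ⟨h1, h2⟩ := coordMap_aeval hE hP f
  -- A constant in the span has zero coefficients at 3, 5, 6, …, hence is zero.
  have hc : MvPolynomial.constantCoeff f = 0 := by
    rw [hf, zero_sub] at h1
    have h := polySpan_eq_of_coeff E h1 (zero_mem _) fun l => by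
      have : (l : ℕ) ≠ 0 := by have := l.2; omega
      simp [Polynomial.coeff_C, this]
    simpa using h
  rw [hf, hc, map_zero, map_zero, sub_zero] at h2
  exact h2.symm

end Relations

/-! ### The quadrics generate all relations. -/

open MvPolynomial in
theorem ker_aeval_basisPoly {E : Idx → Fin 3 → ℂ} (hE : Constraints E) :
    RingHom.ker (aeval (R := ℂ) (basisPoly E)) = fibreIdeal E := by
  apply le_antisymm
  · intro f hf
    -- The universal point at which the quadrics vanish: the classes of the variables modulo
    -- `fibreIdeal E`.
    have hP : QuadricsVanish E fun i => Ideal.Quotient.mk (fibreIdeal E) (X i) := fun i j => by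
      have h : quadric (fun l s => C (E l s)) X i j ∈ fibreIdeal E :=
        Ideal.subset_span ⟨i, j, rfl⟩
      have h2 := Ideal.Quotient.eq_zero_iff_mem.2 h
      rw [← h2]
      simp only [quadric, map_sub, map_mul, map_sum]
      congr 1
      refine Finset.sum_congr rfl fun l _ => ?_
      congr 1
      have h3 := algebraMap_structConst (R := MvPolynomial Idx ℂ) E i j l
      rw [algebraMap_structConst]
      simp only [MvPolynomial.algebraMap_eq] at h3
      rw [h3]; rfl
    have h0 := aeval_eq_zero_of_genPoly hE hP hf
    rw [← Ideal.Quotient.eq_zero_iff_mem, ← h0]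
    have := MvPolynomial.comp_aeval_apply (Ideal.Quotient.mkₐ ℂ (fibreIdeal E))
      (f := (X : Idx → MvPolynomial Idx ℂ)) (p := f)
    simpa using this
  · rw [fibreIdeal, Ideal.span_le]
    rintro _ ⟨i, j, rfl⟩
    have h := genPoly_mul_eq_sum hE i j
    have h3 := algebraMap_structConst (R := MvPolynomial Idx ℂ) E i j
    simp only [MvPolynomial.algebraMap_eq] at h3
    simp only [quadric, SetLike.mem_coe, RingHom.mem_ker, map_sub, map_mul, map_sum, aeval_X, h3,
      basisPoly_eq_genPoly, h, Polynomial.smul_eq_C_mul, aeval_C, Polynomial.algebraMap_eq,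
      sub_self]

open MvPolynomial in
-- The quotient by `gammaIdeal` serves both as base ring and as target. Over it the classes of the
-- `hVar` solve the constraints and the classes of the `pVar` kill the quadrics, so membership
-- reduces to an identity in one variable z.
theorem mem_gammaIdeal_of_aeval (f : MvPolynomial Idx (MvPolynomial Coord ℂ ⧸ gammaIdeal))
    (g : MvPolynomial Coord ℂ)
    (hfg : Ideal.Quotient.mk gammaIdeal g =
      aeval (fun j => Ideal.Quotient.mk gammaIdeal (pVar j)) f)
    (hf : Constraints (fun j s => Ideal.Quotient.mk gammaIdeal (hVar j s)) →
      aeval (genPoly fun j s => Ideal.Quotient.mk gammaIdeal (hVar j s)) f = 0) :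
    g ∈ gammaIdeal := by
  have hc : ∀ x ∈ constraintSet hVar, Ideal.Quotient.mk gammaIdeal x = 0 := fun x hx =>
    Ideal.Quotient.eq_zero_iff_mem.2 (Ideal.subset_span (Or.inl hx))
  have hE : Constraints (fun j s => Ideal.Quotient.mk gammaIdeal (hVar j s)) := by
    intro x hx
    simp only [constraintSet, Set.mem_union, Set.mem_singleton_iff, Set.mem_insert_iff,
      Set.mem_iUnion] at hx
    rcases hx with ((rfl | rfl | rfl | rfl) | rfl | rfl | rfl) | ⟨j, rfl | rfl | rfl⟩
    · exact hc (hVar i3 2) (by simp [constraintSet])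
    · exact hc (hVar i5 0) (by simp [constraintSet])
    · exact hc (hVar i5 1 - hVar i3 0) (by simp [constraintSet])
    · exact hc (hVar i5 2 - hVar i3 1) (by simp [constraintSet])
    · exact hc (hVar i6 0 + hVar i3 0 ^ 2) (by simp [constraintSet])
    · exact hc (hVar i6 1 + 2 * hVar i3 0 * hVar i3 1) (by simp [constraintSet])
    · exact hc (hVar i6 2 + hVar i3 1 ^ 2) (by simp [constraintSet])
    · exact hc (hVar j.addTwo 2 + hVar j 2 * hVar i6 2 - hVar j 1)
        (Or.inr (Set.mem_iUnion.2 ⟨j, by simp⟩))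
    · exact hc (hVar j.addTwo 1 + hVar j 2 * hVar i6 1 - hVar j 0)
        (Or.inr (Set.mem_iUnion.2 ⟨j, by simp⟩))
    · exact hc (hVar j.addTwo 0 + hVar j 2 * hVar i6 0)
        (Or.inr (Set.mem_iUnion.2 ⟨j, by simp⟩))
  have hP : QuadricsVanish (fun j s => Ideal.Quotient.mk gammaIdeal (hVar j s))
      (fun j => Ideal.Quotient.mk gammaIdeal (pVar j)) := fun i j => by
    have h : quadric hVar pVar i j ∈ gammaIdeal := Ideal.subset_span (Or.inr ⟨i, j, rfl⟩)
    rw [← Ideal.Quotient.eq_zero_iff_mem] at h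
    rw [← h]
    simp only [quadric, map_sub, map_mul, map_sum, Algebra.algebraMap_self, RingHom.id_apply,
      structConst, map_add, apply_ite (Ideal.Quotient.mk gammaIdeal), map_one, map_zero]
  rw [← Ideal.Quotient.eq_zero_iff_mem, hfg]
  exact aeval_eq_zero_of_genPoly hE hP (hf hE)

/-! ### The two plane curves in the ideal of Γ_5. -/

theorem map_curve35 {R S F : Type*} [CommRing R] [CommRing S] [FunLike F R S]
    [RingHomClass F R S] (f : F) (a b x y : R) :
    f (curve35 a b x y) = curve35 (f a) (f b) (f x) (f y) := by
  simp only [curve35, map_add, map_sub, map_mul, map_pow, map_ofNat]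

theorem map_curve56 {R S F : Type*} [CommRing R] [CommRing S] [FunLike F R S]
    [RingHomClass F R S] (f : F) (a b x y : R) :
    f (curve56 a b x y) = curve56 (f a) (f b) (f x) (f y) := by
  simp only [curve56, map_add, map_sub, map_mul, map_pow, map_neg, map_ofNat]

open Polynomial in
theorem curve35_genPoly {R : Type*} [CommRing R] {E : Idx → Fin 3 → R} (hE : Constraints E) :
    curve35 (C (E i3 1)) (C (E i3 0)) (genPoly E i3) (genPoly E i5) = 0 := by
  rw [genPoly_i5 hE, genPoly_i3 hE, curve35]
  ring

open Polynomial in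
theorem curve56_genPoly {R : Type*} [CommRing R] {E : Idx → Fin 3 → R} (hE : Constraints E) :
    curve56 (C (E i3 1)) (C (E i3 0)) (genPoly E i5) (genPoly E i6) = 0 := by
  rw [genPoly_i5 hE, genPoly_i6 hE, genPoly_i3 hE, curve56]
  ring

open MvPolynomial in
theorem curve35_mem_gammaIdeal :
    curve35 (hVar i3 1) (hVar i3 0) (pVar i3) (pVar i5) ∈ gammaIdeal := by
  refine mem_gammaIdeal_of_aeval
    (curve35 (C (Ideal.Quotient.mk gammaIdeal (hVar i3 1)))
      (C (Ideal.Quotient.mk gammaIdeal (hVar i3 0))) (X i3) (X i5)) _ ?_ fun hE => ?_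
  · rw [map_curve35, map_curve35]
    simp
  · rw [← curve35_genPoly hE, map_curve35]
    simp [Polynomial.C_eq_algebraMap]

open MvPolynomial in
theorem curve56_mem_gammaIdeal :
    curve56 (hVar i3 1) (hVar i3 0) (pVar i5) (pVar i6) ∈ gammaIdeal := by
  refine mem_gammaIdeal_of_aeval
    (curve56 (C (Ideal.Quotient.mk gammaIdeal (hVar i3 1)))
      (C (Ideal.Quotient.mk gammaIdeal (hVar i3 0))) (X i5) (X i6)) _ ?_ fun hE => ?_
  · rw [map_curve56, map_curve56]
    simp
  · rw [← curve56_genPoly hE, map_curve56]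
    simp [Polynomial.C_eq_algebraMap]

/-! ### Solutions of the constraints -/

/-- Multiplication by `z²` modulo `z⁶ - (a z² + b)²`, on the coefficients of `1, z², z⁴`. -/
def sqStep (a b : ℂ) (v : Fin 3 → ℂ) : Fin 3 → ℂ :=
  ![v 2 * b ^ 2, v 0 + v 2 * (2 * b * a), v 1 + v 2 * a ^ 2]

/-- The solution of the constraints with `H^3_{-2} = a`, `H^3_0 = b`. -/
def solution (a b : ℂ) (j : Idx) : Fin 3 → ℂ :=
  -- The even part of p_j is z^{j-3}(az² + b) for odd j and -z^{j-6}(az² + b)² for even j, reduced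
  -- modulo p_6.
  if Odd (j : ℕ) then (sqStep a b)^[((j : ℕ) - 3) / 2] ![b, a, 0]
  else (sqStep a b)^[((j : ℕ) - 6) / 2] ![-b ^ 2, -(2 * b * a), -a ^ 2]

theorem solution_i3 (a b : ℂ) : solution a b i3 = ![b, a, 0] := by
  simp [solution, i3, show Odd 3 by decide]

theorem solution_i6 (a b : ℂ) : solution a b i6 = ![-b ^ 2, -(2 * b * a), -a ^ 2] := by
  simp [solution, i6, show ¬ Odd 6 by decide]

theorem solution_addTwo (a b : ℂ) (j : Idx) :
    solution a b j.addTwo = sqStep a b (solution a b j) := by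
  have hj := j.2
  have ho : Odd (j + 2 : ℕ) ↔ Odd (j : ℕ) := by simp [Nat.odd_add, show Even 2 by decide]
  simp only [solution, Idx.addTwo_val, ho]
  split_ifs with h
  · rw [show ((j : ℕ) + 2 - 3) / 2 = ((j : ℕ) - 3) / 2 + 1 by omega,
      Function.iterate_succ_apply']
  -- In the even case j ≥ 6, so the truncated subtraction j - 6 is exact.
  · have : (j : ℕ) ≠ 3 ∧ (j : ℕ) ≠ 5 := by
      constructor <;> (intro h'; rw [h'] at h; exact h (by decide))
    rw [show ((j : ℕ) + 2 - 6) / 2 = ((j : ℕ) - 6) / 2 + 1 by omega,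
      Function.iterate_succ_apply']

theorem constraints_solution (a b : ℂ) : Constraints (solution a b) := by
  have h5 : solution a b i5 = ![0, b, a] := by
    rw [← addTwo_i3, solution_addTwo, solution_i3]; simp [sqStep]
  rw [constraints_iff, solution_i3, solution_i6, h5]
  refine ⟨by simp, by simp, by simp, fun j => ?_⟩
  rw [solution_addTwo]
  refine ⟨?_, ?_, ?_⟩ <;> simp [sqStep]

theorem Constraints.ext {E E' : Idx → Fin 3 → ℂ} (hE : Constraints E) (hE' : Constraints E')
    (h1 : E i3 1 = E' i3 1) (h0 : E i3 0 = E' i3 0) : E = E' := by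
  obtain ⟨h3, -, ⟨h60, h61, h62⟩, hj⟩ := (constraints_iff E).1 hE
  obtain ⟨h3', -, ⟨h60', h61', h62'⟩, hj'⟩ := (constraints_iff E').1 hE'
  have hi6 : E i6 = E' i6 := by
    ext s
    fin_cases s
    · simp [h60, h60', h0]
    · simp [h61, h61', h0, h1]
    · simp [h62, h62', h1]
  funext j
  induction j using Idx.induction_addTwo with
  | three =>
    ext s
    fin_cases s
    · exact h0
    · exact h1
    · exact h3.trans h3'.symm
  | six => exact hi6
  | addTwo j ih =>
    ext s
    fin_cases s
    · simp [(hj j).2.2, (hj' j).2.2, ih, hi6]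
    · simp [(hj j).2.1, (hj' j).2.1, ih, hi6]
    · simp [(hj j).1, (hj' j).1, ih, hi6]

theorem existsUnique_constraints (a b : ℂ) :
    ∃! E : Idx → Fin 3 → ℂ, Constraints E ∧ E i3 1 = a ∧ E i3 0 = b := by
  refine ⟨solution a b, ⟨constraints_solution a b, ?_, ?_⟩, fun E hE => ?_⟩
  · simp [solution_i3]
  · simp [solution_i3]
  · exact hE.1.ext (constraints_solution a b) (by simp [solution_i3, hE.2.1])
      (by simp [solution_i3, hE.2.2])

/-! ### The algebra -/

/-- The non-unital subalgebra spanned by the polynomials. -/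
def polyAlgebra {E : Idx → Fin 3 → ℂ} (hE : Constraints E) : NonUnitalSubalgebra ℂ ℂ[X] :=
  { polySpan E with mul_mem' := polySpan_mul hE }

theorem linearIndependent_genPoly (E : Idx → Fin 3 → ℂ) : LinearIndependent ℂ (genPoly E) := by
  rw [linearIndependent_iff]
  intro c hc
  ext l
  rw [← coeff_linearCombination_genPoly E, hc]; simp

/-- The basis of that algebra. -/
def polyAlgebraBasis {E : Idx → Fin 3 → ℂ} (hE : Constraints E) :
    Module.Basis Idx ℂ (polyAlgebra hE) :=
  Module.Basis.span (linearIndependent_genPoly E)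

theorem coe_polyAlgebraBasis {E : Idx → Fin 3 → ℂ} (hE : Constraints E) (j : Idx) :
    (polyAlgebraBasis hE j : ℂ[X]) = genPoly E j :=
  congrArg Subtype.val (Module.Basis.span_apply (linearIndependent_genPoly E) j)

theorem polyAlgebraBasis_repr {E : Idx → Fin 3 → ℂ} (hE : Constraints E) (u : polyAlgebra hE)
    (l : Idx) : (polyAlgebraBasis hE).repr u l = (u : ℂ[X]).coeff l := by
  rw [← coeff_linearCombination_genPoly E]
  congr 1
  conv_rhs => rw [← (polyAlgebraBasis hE).linearCombination_repr u]
  simp only [Finsupp.linearCombination_apply, Finsupp.sum]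
  rw [AddSubmonoidClass.coe_finsetSum]
  refine Finset.sum_congr rfl fun i _ => ?_
  rw [← coe_polyAlgebraBasis hE]; rfl

theorem infinite_idx : Infinite Idx :=
  Infinite.of_injective (fun n : ℕ => (⟨n + 5, Or.inr (by omega)⟩ : Idx)) fun m n h => by
    simpa using congrArg Subtype.val h

theorem exists_polyAlgebra {E : Idx → Fin 3 → ℂ} (hE : Constraints E) :
    ∃ (A : NonUnitalSubalgebra ℂ (Polynomial ℂ)) (β : Module.Basis Idx ℂ A),
      (∀ j, (β j : Polynomial ℂ) = basisPoly E j) ∧ ¬ Module.Finite ℂ A ∧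
        ∀ j k l, β.repr (β j * β k) l = structConst E j k l := by
  refine ⟨polyAlgebra hE, polyAlgebraBasis hE, coe_polyAlgebraBasis hE, fun h => ?_,
    fun j k l => ?_⟩
  · have := infinite_idx
    have := Module.Finite.finite_basis (polyAlgebraBasis hE)
    exact not_finite Idx
  · rw [polyAlgebraBasis_repr, ← coeff_genPoly_mul, ← coe_polyAlgebraBasis hE,
      ← coe_polyAlgebraBasis hE]
    rfl

/-! ### Coefficients of Laurent series -/

theorem zcoeff_add (f g : LaurentSeries ℂ) (n : ℤ) :
    zcoeff (f + g) n = zcoeff f n + zcoeff g n := rfl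

theorem zcoeff_sub (f g : LaurentSeries ℂ) (n : ℤ) :
    zcoeff (f - g) n = zcoeff f n - zcoeff g n := rfl

theorem zcoeff_smul (c : ℂ) (f : LaurentSeries ℂ) (n : ℤ) :
    zcoeff (c • f) n = c * zcoeff f n := rfl

theorem laurent_zero_smul (f : LaurentSeries ℂ) : (0 : ℂ) • f = 0 := zero_smul ℂ f

theorem laurent_two_smul (f : LaurentSeries ℂ) : (2 : ℂ) • f = f + f := two_smul ℂ f

theorem zcoeff_sum {ι : Type*} (s : Finset ι) (f : ι → LaurentSeries ℂ) (n : ℤ) :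
    zcoeff (∑ i ∈ s, f i) n = ∑ i ∈ s, zcoeff (f i) n := by
  simp [zcoeff, HahnSeries.coeff_sum]

theorem zcoeff_ext {f g : LaurentSeries ℂ} (h : ∀ n, zcoeff f n = zcoeff g n) : f = g := by
  ext n
  simpa [zcoeff] using h (-n)

theorem zcoeff_single_mul (m : ℤ) (f : LaurentSeries ℂ) (n : ℤ) :
    zcoeff (HahnSeries.single (-m) 1 * f) n = zcoeff f (n - m) := by
  rw [zcoeff, HahnSeries.coeff_single_mul, one_mul, zcoeff]
  congr 1; ring

theorem z_pow (k : ℕ) : z ^ k = HahnSeries.single (-(k : ℤ)) 1 := by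
  simp [z, HahnSeries.single_pow]

theorem zcoeff_z_pow_mul (k : ℕ) (f : LaurentSeries ℂ) (n : ℤ) :
    zcoeff (z ^ k * f) n = zcoeff f (n - k) := by
  rw [z_pow, zcoeff_single_mul]

theorem zcoeff_z_pow (k : ℕ) (n : ℤ) : zcoeff (z ^ k) n = if n = k then 1 else 0 := by
  rw [z_pow, zcoeff, HahnSeries.coeff_single]
  simp

theorem zcoeff_one (n : ℤ) : zcoeff 1 n = if n = 0 then 1 else 0 := by
  simpa using zcoeff_z_pow 0 n

theorem zcoeff_mul_eq_zero {f g : LaurentSeries ℂ} {n : ℤ}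
    (h : ∀ i j, i + j = n → zcoeff f i = 0 ∨ zcoeff g j = 0) : zcoeff (f * g) n = 0 := by
  rw [zcoeff, HahnSeries.coeff_mul]
  refine Finset.sum_eq_zero fun ij hij => ?_
  have h1 := (Finset.mem_antidiagonal.1 hij).2.2
  have h2 := h (-ij.1) (-ij.2) (by rw [← neg_add, h1, neg_neg])
  simp only [zcoeff, neg_neg] at h2
  rcases h2 with h2 | h2 <;> simp [h2]

theorem zcoeff_ofPowerSeries (f : PowerSeries ℂ) (n : ℤ) :
    zcoeff (HahnSeries.ofPowerSeries ℤ ℂ f) n =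
      if n ≤ 0 then PowerSeries.coeff (-n).toNat f else 0 := by
  rw [zcoeff]
  split_ifs with h
  · have := HahnSeries.ofPowerSeries_apply_coeff (Γ := ℤ) f (-n).toNat
    rwa [Int.toNat_of_nonneg (by omega)] at this
  · rw [HahnSeries.ofPowerSeries_apply]
    refine HahnSeries.embDomain_of_notMem_range fun ⟨m, hm⟩ => ?_
    simp at hm
    omega

theorem zcoeff_series (H : Idx → ℤ → ℂ) (j : Idx) (n : ℤ) :
    zcoeff (series H j) n = (if n = ((j : ℕ) : ℤ) then 1 else 0) +
      (if n = 4 then H j (-4) else 0) + (if n = 2 then H j (-2) else 0) +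
      (if n = 0 then H j 0 else 0) + if n < 0 then H j (-n) else 0 := by
  have h : zcoeff (HahnSeries.ofPowerSeries ℤ ℂ
      (PowerSeries.mk fun k : ℕ => if k = 0 then 0 else H j k)) n =
      if n < 0 then H j (-n) else 0 := by
    rw [zcoeff_ofPowerSeries, PowerSeries.coeff_mk]
    rcases lt_trichotomy n 0 with h | h | h
    · rw [if_pos h.le, if_pos h, if_neg (by omega), Int.toNat_of_nonneg (by omega)]
    · simp [h]
    · rw [if_neg (by omega), if_neg (by omega)]
  simp only [series, zcoeff_add, zcoeff_smul, zcoeff_z_pow, zcoeff_one, h]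
  simp

theorem zcoeff_series_idx (H : Idx → ℤ → ℂ) (j l : Idx) :
    zcoeff (series H j) ((l : ℕ) : ℤ) = if l = j then 1 else 0 := by
  have := l.2
  rw [zcoeff_series, if_neg (by omega : ¬((l : ℕ) : ℤ) = 4),
    if_neg (by omega : ¬((l : ℕ) : ℤ) = 2), if_neg (by omega : ¬((l : ℕ) : ℤ) = 0),
    if_neg (by omega : ¬((l : ℕ) : ℤ) < 0)]
  simp [Subtype.ext_iff]

theorem zcoeff_sum_series (H : Idx → ℤ → ℂ) (c : Idx →₀ ℂ) (l : Idx) :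
    zcoeff (c.sum fun l c => c • series H l) ((l : ℕ) : ℤ) = c l := by
  rw [Finsupp.sum, zcoeff_sum]
  simp only [zcoeff_smul, zcoeff_series_idx, mul_ite, mul_one, mul_zero]
  rw [Finset.sum_ite_eq]
  split_ifs with h
  · rfl
  · exact (Finsupp.notMem_support_iff.1 h).symm

/-- An element of the span is determined by its coefficients at `3, 5, 6, …`. -/
theorem series_span_eq_of_zcoeff (H : Idx → ℤ → ℂ) {f g : LaurentSeries ℂ}
    (hf : f ∈ Submodule.span ℂ (Set.range (series H)))
    (hg : g ∈ Submodule.span ℂ (Set.range (series H)))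
    (h : ∀ l : Idx, zcoeff f ((l : ℕ) : ℤ) = zcoeff g ((l : ℕ) : ℤ)) : f = g := by
  obtain ⟨c, rfl⟩ := (Finsupp.mem_span_range_iff_exists_finsupp).1 hf
  obtain ⟨d, rfl⟩ := (Finsupp.mem_span_range_iff_exists_finsupp).1 hg
  have hcd : c = d := by
    ext l
    have := h l
    rwa [zcoeff_sum_series, zcoeff_sum_series] at this
  rw [hcd]

/-! ### Polynomials as Laurent series -/

/-- The algebra structure comes through power series while the scalar multiplication is
coefficientwise; this identifies the two. -/
theorem algebraMap_mul_eq_smul (c : ℂ) (f : LaurentSeries ℂ) :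
    algebraMap ℂ (LaurentSeries ℂ) c * f = c • f := by
  rw [← HahnSeries.C_mul_eq_smul, HahnSeries.algebraMap_apply', ← PowerSeries.C_eq_algebraMap,
    HahnSeries.ofPowerSeries_C]

theorem polyToLaurent_smul (c : ℂ) (f : ℂ[X]) : polyToLaurent (c • f) = c • polyToLaurent f := by
  rw [Polynomial.smul_eq_C_mul, map_mul, polyToLaurent, Polynomial.aeval_C, algebraMap_mul_eq_smul]

/-- The inclusion of the polynomials as a linear map for the coefficientwise scalar
multiplication of Laurent series. -/
def polyToLaurentₗ : ℂ[X] →ₗ[ℂ] LaurentSeries ℂ where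
  toFun := polyToLaurent
  map_add' := map_add polyToLaurent
  map_smul' := polyToLaurent_smul

theorem polyToLaurent_genPoly (E : Idx → Fin 3 → ℂ) (j : Idx) :
    polyToLaurent (genPoly E j) = z ^ (j : ℕ) + E j 2 • z ^ 4 + E j 1 • z ^ 2 + E j 0 • 1 := by
  rw [genPoly_eq]
  simp only [← algebraMap_mul_eq_smul, mul_one]
  simp [polyToLaurent]

theorem zcoeff_polyToLaurent (f : ℂ[X]) (n : ℕ) : zcoeff (polyToLaurent f) n = f.coeff n := by
  induction f using Polynomial.induction_on' with
  | add f g hf hg => rw [map_add, zcoeff_add, hf, hg, Polynomial.coeff_add]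
  | monomial m c =>
    have : polyToLaurent (Polynomial.monomial m c) = c • z ^ m := by
      rw [← algebraMap_mul_eq_smul, polyToLaurent, Polynomial.aeval_monomial]
    rw [this, zcoeff_smul, zcoeff_z_pow, Polynomial.coeff_monomial]
    simp [eq_comm]

theorem polyToLaurent_injective : Function.Injective polyToLaurent := fun f g h => by
  ext n
  rw [← zcoeff_polyToLaurent, h, zcoeff_polyToLaurent]

theorem zcoeff_genPoly (E : Idx → Fin 3 → ℂ) (j : Idx) (n : ℤ) :
    zcoeff (polyToLaurent (genPoly E j)) n = (if n = ((j : ℕ) : ℤ) then 1 else 0) +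
      (if n = 4 then E j 2 else 0) + (if n = 2 then E j 1 else 0) +
      (if n = 0 then E j 0 else 0) := by
  simp only [polyToLaurent_genPoly, zcoeff_add, zcoeff_smul, zcoeff_z_pow, zcoeff_one]
  simp

theorem series_eq_polyToLaurent {H : Idx → ℤ → ℂ} (hH : ∀ j, ∀ k : ℤ, 1 ≤ k → H j k = 0) :
    series H = fun j => polyToLaurent (genPoly (evenPart H) j) := by
  funext j
  refine zcoeff_ext fun n => ?_
  rw [zcoeff_series, zcoeff_genPoly]
  have h : (if n < 0 then H j (-n) else 0) = 0 := by
    split_ifs with h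
    · exact hH j _ (by omega)
    · rfl
  rw [h, add_zero]
  rfl

/-- The span of the polynomials in the Laurent series. -/
def laurentSpan (E : Idx → Fin 3 → ℂ) : Submodule ℂ (LaurentSeries ℂ) :=
  Submodule.span ℂ (Set.range fun j => polyToLaurent (basisPoly E j))

theorem laurentSpan_eq_map (E : Idx → Fin 3 → ℂ) :
    laurentSpan E = (polySpan E).map polyToLaurentₗ := by
  rw [polySpan, Submodule.map_span, ← Set.range_comp]
  rfl

theorem mulClosed_laurentSpan {E : Idx → Fin 3 → ℂ} (hE : Constraints E) :
    MulClosed (laurentSpan E) := by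
  rw [laurentSpan_eq_map]
  rintro _ ⟨f, hf, rfl⟩ _ ⟨g, hg, rfl⟩
  exact ⟨f * g, polySpan_mul hE hf hg, map_mul polyToLaurent f g⟩

theorem sqInvariant_laurentSpan {E : Idx → Fin 3 → ℂ} (hE : Constraints E) :
    SqInvariant (laurentSpan E) := by
  rw [laurentSpan_eq_map]
  rintro _ ⟨f, hf, rfl⟩
  refine ⟨Polynomial.X ^ 2 * f, polySpan_sq hE hf, ?_⟩
  simp [polyToLaurentₗ, polyToLaurent]

/-- p_j is the only element of the span with coefficient 1 at j and 0 at the other indices, so the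
span determines the p_j and with them all H^j_{-2s}. -/
theorem laurentSpan_injective {E E' : Idx → Fin 3 → ℂ} (h : laurentSpan E = laurentSpan E') :
    E = E' := by
  have hp : polySpan E = polySpan E' := by
    rw [laurentSpan_eq_map, laurentSpan_eq_map] at h
    exact Submodule.map_injective_of_injective (f := polyToLaurentₗ) polyToLaurent_injective h
  funext j s
  have : genPoly E j = genPoly E' j :=
    polySpan_eq_of_coeff E (genPoly_mem E j) (by rw [hp]; exact genPoly_mem E' j) fun l => by
      rw [coeff_genPoly, coeff_genPoly]
  rw [← coeff_genPoly_even E, this, coeff_genPoly_even]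

/-! ### Closed spans of series are spans of polynomials -/

section Closed

variable {H : Idx → ℤ → ℂ}

theorem series_mem (H : Idx → ℤ → ℂ) (j : Idx) :
    series H j ∈ Submodule.span ℂ (Set.range (series H)) :=
  Submodule.subset_span ⟨j, rfl⟩

/-- Multiplication by z² moves the exponents 4, 2, 0 to 6, 4, 2 and negative ones to at most 1; only
j + 2 and 6 are indices. -/
theorem z_sq_mul_series (hsq : SqInvariant (Submodule.span ℂ (Set.range (series H)))) (j : Idx) :
    z ^ 2 * series H j = series H j.addTwo + H j (-4) • series H i6 := by
  refine series_span_eq_of_zcoeff H (hsq _ (series_mem H j))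
    (add_mem (series_mem H _) (Submodule.smul_mem _ _ (series_mem H _))) fun l => ?_
  have hl := l.2
  rw [zcoeff_z_pow_mul, zcoeff_add, zcoeff_smul, zcoeff_series_idx, zcoeff_series_idx,
    zcoeff_series, if_neg (by omega : ¬((l : ℕ) : ℤ) - (2 : ℕ) = 2),
    if_neg (by omega : ¬((l : ℕ) : ℤ) - (2 : ℕ) = 0),
    if_neg (by omega : ¬((l : ℕ) : ℤ) - (2 : ℕ) < 0)]
  have h1 : ((l : ℕ) : ℤ) - (2 : ℕ) = ((j : ℕ) : ℤ) ↔ l = j.addTwo := by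
    rw [Subtype.ext_iff, Idx.addTwo_val]; omega
  have h2 : ((l : ℕ) : ℤ) - (2 : ℕ) = 4 ↔ l = i6 := by
    rw [Subtype.ext_iff]; simp only [i6]; omega
  simp only [h1, h2, add_zero, mul_ite, mul_one, mul_zero]

/-- No p_j contains z¹, and the coefficient of f at 1 - 2k is that of z^{2k} f at 1. -/
theorem zcoeff_odd_eq_zero (hsq : SqInvariant (Submodule.span ℂ (Set.range (series H))))
    {f : LaurentSeries ℂ} (hf : f ∈ Submodule.span ℂ (Set.range (series H))) (k : ℕ) :
    zcoeff f (1 - 2 * k) = 0 := by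
  induction k generalizing f with
  | zero =>
    rw [Nat.cast_zero, mul_zero, sub_zero]
    induction hf using Submodule.span_induction with
    | mem x hx =>
      obtain ⟨j, rfl⟩ := hx
      have hj := j.2
      rw [zcoeff_series, if_neg (by omega)]
      simp
    | zero => rfl
    | add x y _ _ hx hy => rw [zcoeff_add, hx, hy, add_zero]
    | smul c x _ hx => rw [zcoeff_smul, hx, mul_zero]
  | succ k ih =>
    have := ih (hsq f hf)
    rw [zcoeff_z_pow_mul] at this
    rw [← this]
    congr 1
    push_cast; ring

theorem zcoeff_series_i3_sub (hsq : SqInvariant (Submodule.span ℂ (Set.range (series H)))) {n : ℤ}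
    (hn : Odd n) : zcoeff (series H i3 - z ^ 3) n = 0 := by
  obtain ⟨m, rfl⟩ := hn
  rw [zcoeff_sub, zcoeff_z_pow]
  by_cases hm : m ≤ 0
  · have := zcoeff_odd_eq_zero hsq (series_mem H i3) (-m).toNat
    rw [Int.toNat_of_nonneg (by omega)] at this
    rw [if_neg (by omega), sub_zero, ← this]
    congr 1; ring
  · rw [zcoeff_series, if_neg (by omega : ¬2 * m + 1 = 2), if_neg (by omega : ¬2 * m + 1 = 0),
      if_neg (by omega : ¬2 * m + 1 < 0), if_neg (by omega : ¬2 * m + 1 = 4)]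
    simp only [i3, add_zero]
    exact sub_self _

theorem zcoeff_series_i3_sub_of_two_lt (hH : H i3 (-4) = 0) {n : ℤ} (hn : 2 < n) :
    zcoeff (series H i3 - z ^ 3) n = 0 := by
  rw [zcoeff_sub, zcoeff_z_pow, zcoeff_series, if_neg (by omega : ¬n = 2),
      if_neg (by omega : ¬n = 0), if_neg (by omega : ¬n < 0), hH]
  simp only [i3, add_zero, ite_self]
  exact sub_self _

/-- Write p_3 = z³ + g with g even: in p_3² = z⁶ + 2z³g + g² only the middle term is odd. -/
theorem zcoeff_series_i3_mul_self_of_odd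
    (hsq : SqInvariant (Submodule.span ℂ (Set.range (series H)))) {n : ℤ} (hn : Odd n) :
    zcoeff (series H i3 * series H i3) n = 2 * zcoeff (series H i3 - z ^ 3) (n - 3) := by
  have h : series H i3 * series H i3 = z ^ 6 + (2 : ℂ) • (z ^ 3 * (series H i3 - z ^ 3)) +
      (series H i3 - z ^ 3) * (series H i3 - z ^ 3) := by
    rw [laurent_two_smul]; ring
  have h0 : zcoeff ((series H i3 - z ^ 3) * (series H i3 - z ^ 3)) n = 0 := by
    refine zcoeff_mul_eq_zero fun i j hij => ?_
    rcases Int.even_or_odd i with hi | hi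
    · exact Or.inr (zcoeff_series_i3_sub hsq (by
        rw [← hij, Int.odd_add] at hn
        rw [← Int.not_even_iff_odd] at hn ⊢
        tauto))
    · exact Or.inl (zcoeff_series_i3_sub hsq hi)
  have h6 : n ≠ (6 : ℕ) := by rintro rfl; exact absurd hn (by decide)
  rw [h, zcoeff_add, zcoeff_add, h0, zcoeff_smul, zcoeff_z_pow_mul, zcoeff_z_pow, if_neg h6]
  simp

/-- Compare coefficients at the indices. With p_3 = z³ + g and g of order at most 2, the even
indices see only z⁶, and the odd ones see 2z³g, that is, the coefficients of g at 2 and 0. -/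
theorem series_i3_mul_self (hH : H i3 (-4) = 0)
    (hmul : MulClosed (Submodule.span ℂ (Set.range (series H))))
    (hsq : SqInvariant (Submodule.span ℂ (Set.range (series H)))) :
    series H i3 * series H i3 =
      series H i6 + (2 * H i3 (-2)) • series H i5 + (2 * H i3 0) • series H i3 := by
  refine series_span_eq_of_zcoeff H (hmul _ (series_mem H _) _ (series_mem H _))
    (add_mem (add_mem (series_mem H _) (Submodule.smul_mem _ _ (series_mem H _)))
      (Submodule.smul_mem _ _ (series_mem H _))) fun l => ?_
  have hl := l.2
  simp only [zcoeff_add, zcoeff_smul, zcoeff_series_idx, Subtype.ext_iff, i3, i5, i6]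
  rcases Int.even_or_odd ((l : ℕ) : ℤ) with he | ho
  · have h : series H i3 * series H i3 = z ^ 6 + (2 : ℂ) • (z ^ 3 * (series H i3 - z ^ 3)) +
        (series H i3 - z ^ 3) * (series H i3 - z ^ 3) := by
      rw [laurent_two_smul]; ring
    have hl6 : 6 ≤ (l : ℕ) := by
      obtain ⟨m, hm⟩ := he
      omega
    have h0 : zcoeff ((series H i3 - z ^ 3) * (series H i3 - z ^ 3)) ((l : ℕ) : ℤ) = 0 :=
      zcoeff_mul_eq_zero fun i j hij => by
        by_cases hi : 2 < i
        · exact Or.inl (zcoeff_series_i3_sub_of_two_lt hH hi)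
        · exact Or.inr (zcoeff_series_i3_sub_of_two_lt hH (by omega))
    change zcoeff (series H i3 * series H i3) _ = _
    rw [h, zcoeff_add, zcoeff_add, h0, zcoeff_smul, zcoeff_z_pow_mul, zcoeff_z_pow,
      zcoeff_series_i3_sub_of_two_lt hH (by omega), if_neg (by omega : ¬(l : ℕ) = 5),
      if_neg (by omega : ¬(l : ℕ) = 3)]
    simp only [Nat.cast_inj, mul_zero, add_zero]
  · change zcoeff (series H i3 * series H i3) _ = _
    rw [zcoeff_series_i3_mul_self_of_odd hsq ho, zcoeff_sub, zcoeff_z_pow, zcoeff_series]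
    by_cases h3 : (l : ℕ) = 3
    · simp [h3, i3]
    by_cases h5 : (l : ℕ) = 5
    · simp [h5, i3]
    have hl7 : 7 ≤ (l : ℕ) := by
      obtain ⟨m, hm⟩ := ho
      omega
    rw [if_neg (by omega : ¬(l : ℕ) = 5), if_neg (by omega : ¬(l : ℕ) = 3),
      if_neg (by obtain ⟨m, hm⟩ := ho; omega : ¬(l : ℕ) = 6), hH,
      if_neg (by omega : ¬((l : ℕ) : ℤ) - 3 = 2), if_neg (by omega : ¬((l : ℕ) : ℤ) - 3 = 0),
      if_neg (by omega : ¬((l : ℕ) : ℤ) - 3 < 0)]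
    simp only [i3, add_zero, ite_self, mul_zero, mul_eq_zero]
    exact Or.inr (sub_self _)

/-- The decisive case is p_3. Then p_5 = z² p_3, p_6 is a combination of p_3², p_5 and p_3, and the
rest follow by the recursion. -/
theorem zcoeff_neg_eq_zero (hH : H i3 (-4) = 0)
    (hmul : MulClosed (Submodule.span ℂ (Set.range (series H))))
    (hsq : SqInvariant (Submodule.span ℂ (Set.range (series H)))) (j : Idx) {n : ℤ} (hn : n < 0) :
    zcoeff (series H j) n = 0 := by
  have hs := series_i3_mul_self hH hmul hsq
  have h3 : ∀ n < 0, zcoeff (series H i3) n = 0 := by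
    intro n hn
    rcases Int.even_or_odd n with ⟨m, hm⟩ | ⟨m, hm⟩
    -- For even n < 0 the exponent n + 3 is odd and at most 1, hence absent from p_3², whose
    -- coefficient there is twice that of p_3 at n.
    · have ho : Odd (n + 3) := ⟨m + 1, by omega⟩
      have h1 := zcoeff_series_i3_mul_self_of_odd hsq ho
      have h2 : ∀ j, zcoeff (series H j) (n + 3) = 0 := fun j => by
        have := zcoeff_odd_eq_zero hsq (series_mem H j) (-m - 1).toNat
        rw [Int.toNat_of_nonneg (by omega)] at this
        rw [← this]
        congr 1; omega
      rw [hs, zcoeff_add, zcoeff_add, zcoeff_smul, zcoeff_smul, h2, h2, h2, add_sub_cancel_right,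
        zcoeff_sub, zcoeff_z_pow, if_neg (by omega)] at h1
      simpa using h1.symm
    · have := zcoeff_odd_eq_zero hsq (series_mem H i3) (-m).toNat
      rw [Int.toNat_of_nonneg (by omega)] at this
      rw [← this]
      congr 1; omega
  have h5 : ∀ n < 0, zcoeff (series H i5) n = 0 := by
    intro n hn
    have := z_sq_mul_series hsq i3
    rw [hH, laurent_zero_smul, add_zero, addTwo_i3] at this
    rw [← this, zcoeff_z_pow_mul]
    exact h3 _ (by omega)
  have h6 : ∀ n < 0, zcoeff (series H i6) n = 0 := by
    intro n hn
    have h0 : zcoeff (series H i3 * series H i3) n = 0 := zcoeff_mul_eq_zero fun i j hij => by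
      by_cases hi : i < 0
      · exact Or.inl (h3 _ hi)
      · exact Or.inr (h3 _ (by omega))
    rw [hs, zcoeff_add, zcoeff_add, zcoeff_smul, zcoeff_smul, h3 n hn, h5 n hn] at h0
    simpa using h0
  induction j using Idx.induction_addTwo generalizing n with
  | three => exact h3 n hn
  | six => exact h6 n hn
  | addTwo j ih =>
    have h := congrArg (fun f => zcoeff f n) (z_sq_mul_series hsq j)
    simp only [zcoeff_z_pow_mul, zcoeff_add, zcoeff_smul, h6 n hn, mul_zero, add_zero] at h
    rw [← h]
    exact ih (by omega)

theorem negative_eq_zero (hH : H i3 (-4) = 0)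
    (hmul : MulClosed (Submodule.span ℂ (Set.range (series H))))
    (hsq : SqInvariant (Submodule.span ℂ (Set.range (series H)))) (j : Idx) (k : ℤ) (hk : 1 ≤ k) :
    H j k = 0 := by
  have h := zcoeff_neg_eq_zero hH hmul hsq j (n := -k) (by omega)
  have := j.2
  rw [zcoeff_series, if_neg (by omega), if_neg (by omega), if_neg (by omega), if_neg (by omega),
    if_pos (by omega), neg_neg] at h
  simpa using h

/-- Once the series are polynomials, the constraints are the even coefficients of the formulas for
z² p_j and p_3². -/
theorem constraints_evenPart (hH : H i3 (-4) = 0)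
    (hmul : MulClosed (Submodule.span ℂ (Set.range (series H))))
    (hsq : SqInvariant (Submodule.span ℂ (Set.range (series H)))) : Constraints (evenPart H) := by
  have hneg := negative_eq_zero hH hmul hsq
  have hser := series_eq_polyToLaurent hneg
  have hH' : evenPart H i3 2 = 0 := hH
  have hsq' : ∀ j, Polynomial.X ^ 2 * genPoly (evenPart H) j = genPoly (evenPart H) j.addTwo +
      Polynomial.C (evenPart H j 2) * genPoly (evenPart H) i6 := fun j => by
    have h := z_sq_mul_series hsq j
    rw [hser] at h
    apply polyToLaurent_injective
    rw [← Polynomial.smul_eq_C_mul, map_mul, map_add, polyToLaurent_smul, map_pow]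
    rw [show polyToLaurent Polynomial.X = z from Polynomial.aeval_X z]
    exact h
  have hmul' : genPoly (evenPart H) i3 * genPoly (evenPart H) i3 = genPoly (evenPart H) i6 +
      Polynomial.C (2 * evenPart H i3 1) * genPoly (evenPart H) i5 +
      Polynomial.C (2 * evenPart H i3 0) * genPoly (evenPart H) i3 := by
    have h := series_i3_mul_self hH hmul hsq
    rw [hser] at h
    apply polyToLaurent_injective
    rw [← Polynomial.smul_eq_C_mul, ← Polynomial.smul_eq_C_mul, map_mul, map_add, map_add,
      polyToLaurent_smul, polyToLaurent_smul]
    exact h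
  generalize evenPart H = E at *
  have hrec : ∀ j : Idx, E j.addTwo 2 = E j 1 - E j 2 * E i6 2 ∧
        E j.addTwo 1 = E j 0 - E j 2 * E i6 1 ∧ E j.addTwo 0 = -(E j 2 * E i6 0) := by
    intro j
    have hc : ∀ s : Fin 3, (Polynomial.X ^ 2 * genPoly E j).coeff (2 * s) =
        E j.addTwo s + E j 2 * E i6 s := fun s => by
      rw [hsq', Polynomial.coeff_add, Polynomial.coeff_C_mul, coeff_genPoly_even,
        coeff_genPoly_even]
    have h1 := coeff_genPoly_even E j 1
    have h0 := coeff_genPoly_even E j 0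
    refine ⟨?_, ?_, ?_⟩
    · have := hc 2
      rw [show 2 * ((2 : Fin 3) : ℕ) = 2 * ((1 : Fin 3) : ℕ) + 2 by rfl, mul_comm,
        Polynomial.coeff_mul_X_pow, h1] at this
      linear_combination -this
    · have := hc 1
      rw [show 2 * ((1 : Fin 3) : ℕ) = 2 * ((0 : Fin 3) : ℕ) + 2 by rfl, mul_comm,
        Polynomial.coeff_mul_X_pow, h0] at this
      linear_combination -this
    · have := hc 0
      rw [mul_comm, Polynomial.coeff_mul_X_pow', if_neg (by simp)] at this
      linear_combination -this
  -- With e = az² + b, the formula for p_3² gives p_6 = p_3(p_3 - 2e) = (z³ + e)(z³ - e).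
  have h6 : genPoly E i6 =
      Polynomial.X ^ 6 - (Polynomial.C (E i3 1) * Polynomial.X ^ 2 + Polynomial.C (E i3 0)) ^ 2 := by
    have h5 : genPoly E i5 = Polynomial.X ^ 2 * genPoly E i3 := by
      rw [hsq' i3, hH']; simp [addTwo_i3]
    have h3 : genPoly E i3 = Polynomial.X ^ 3 + Polynomial.C (E i3 1) * Polynomial.X ^ 2 +
        Polynomial.C (E i3 0) := by
      rw [genPoly_eq, hH']; simp [i3]
    rw [h5, h3] at hmul'
    simp only [map_mul, map_ofNat] at hmul'
    linear_combination -hmul'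
  have h6' : genPoly E i6 = Polynomial.X ^ 6 + Polynomial.C (-E i3 1 ^ 2) * Polynomial.X ^ 4 +
      Polynomial.C (-(2 * E i3 0 * E i3 1)) * Polynomial.X ^ 2 + Polynomial.C (-E i3 0 ^ 2) := by
    rw [h6]
    simp only [map_mul, map_neg, map_pow, map_ofNat]
    ring
  rw [constraints_iff]
  refine ⟨hH', ?_, ⟨?_, ?_, ?_⟩, hrec⟩
  -- The constraints on p_5 are the case j = 3 of the recursion, as H^3_{-4} = 0.
  · obtain ⟨h2, h1, h0⟩ := hrec i3
    rw [addTwo_i3] at h2 h1 h0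
    simp [h2, h1, h0, hH']
  · rw [← coeff_genPoly_even E, h6']
    simp only [Polynomial.coeff_add, Polynomial.coeff_C_mul, Polynomial.coeff_X_pow,
      Polynomial.coeff_C]
    simp
  · rw [← coeff_genPoly_even E, h6']
    simp only [Polynomial.coeff_add, Polynomial.coeff_C_mul, Polynomial.coeff_X_pow,
      Polynomial.coeff_C]
    simp
  · rw [← coeff_genPoly_even E, h6']
    simp only [Polynomial.coeff_add, Polynomial.coeff_C_mul, Polynomial.coeff_X_pow,
      Polynomial.coeff_C]
    simp

end Closed

/-! ### The closedness criterion and the structure constants. -/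

theorem mulClosed_span_range {ι : Type*} {p : ι → LaurentSeries ℂ}
    (h : ∀ j k, p j * p k ∈ Submodule.span ℂ (Set.range p)) :
    MulClosed (Submodule.span ℂ (Set.range p)) := by
  intro f hf g hg
  induction hf using Submodule.span_induction with
  | zero => rw [zero_mul]; exact zero_mem _
  | add x y _ _ hx hy => rw [add_mul]; exact add_mem hx hy
  | smul c x _ hx =>
    rw [← HahnSeries.C_mul_eq_smul, mul_assoc, HahnSeries.C_mul_eq_smul]
    exact Submodule.smul_mem _ _ hx
  | mem x hx =>
    obtain ⟨j, rfl⟩ := hx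
    induction hg using Submodule.span_induction with
    | zero => rw [mul_zero]; exact zero_mem _
    | add x y _ _ hx hy => rw [mul_add]; exact add_mem hx hy
    | smul c x _ hx =>
      rw [← HahnSeries.C_mul_eq_smul, mul_left_comm, HahnSeries.C_mul_eq_smul]
      exact Submodule.smul_mem _ _ hx
    | mem x hx =>
      obtain ⟨k, rfl⟩ := hx
      exact h j k

theorem mulClosed_series_iff (H : Idx → ℤ → ℂ) :
    (∃ C : Idx → Idx → (Idx →₀ ℂ), ∀ j k,
      series H j * series H k = (C j k).sum fun l c => c • series H l) ↔
    MulClosed (Submodule.span ℂ (Set.range (series H))) := by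
  constructor
  · rintro ⟨C, hC⟩
    exact mulClosed_span_range fun j k =>
      (Finsupp.mem_span_range_iff_exists_finsupp).2 ⟨C j k, (hC j k).symm⟩
  · intro h
    have h' : ∀ j k, ∃ c : Idx →₀ ℂ, (c.sum fun l c => c • series H l) = series H j * series H k :=
      fun j k => (Finsupp.mem_span_range_iff_exists_finsupp).1
        (h _ (series_mem H j) _ (series_mem H k))
    choose C hC using h'
    exact ⟨C, fun j k => (hC j k).symm⟩

theorem closed_series_iff {H : Idx → ℤ → ℂ} (hH : H i3 (-4) = 0) :
    ((∃ C : Idx → Idx → (Idx →₀ ℂ), ∀ j k,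
        series H j * series H k = (C j k).sum fun l c => c • series H l) ∧
      SqInvariant (Submodule.span ℂ (Set.range (series H)))) ↔
    ((∀ j, ∀ k : ℤ, 1 ≤ k → H j k = 0) ∧ Constraints (evenPart H)) := by
  rw [mulClosed_series_iff]
  constructor
  · rintro ⟨hmul, hsq⟩
    exact ⟨negative_eq_zero hH hmul hsq, constraints_evenPart hH hmul hsq⟩
  · rintro ⟨hneg, hE⟩
    rw [series_eq_polyToLaurent hneg]
    exact ⟨mulClosed_laurentSpan hE, sqInvariant_laurentSpan hE⟩

theorem structConst_of_series {H : Idx → ℤ → ℂ} (hH : H i3 (-4) = 0)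
    (hsq : SqInvariant (Submodule.span ℂ (Set.range (series H))))
    {C : Idx → Idx → (Idx →₀ ℂ)}
    (hC : ∀ j k, series H j * series H k = (C j k).sum fun l c => c • series H l) (j k l : Idx) :
    C j k l = structConst (evenPart H) j k l := by
  have hmul := (mulClosed_series_iff H).1 ⟨C, hC⟩
  have h := congrArg (fun f => zcoeff f ((l : ℕ) : ℤ)) (hC j k)
  simp only [zcoeff_sum_series] at h
  rw [← h, series_eq_polyToLaurent (negative_eq_zero hH hmul hsq), ← map_mul,
    zcoeff_polyToLaurent, coeff_genPoly_mul]

/-! ### Orders -/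

theorem HasOrder.ne_zero {f : LaurentSeries ℂ} {n : ℤ} (h : HasOrder f n) : f ≠ 0 := by
  rintro rfl
  exact h.1 rfl

theorem HasOrder.unique {f : LaurentSeries ℂ} {m n : ℤ} (hm : HasOrder f m) (hn : HasOrder f n) :
    m = n := by
  rcases lt_trichotomy m n with h | h | h
  · exact absurd (hm.2 n h) hn.1
  · exact h
  · exact absurd (hn.2 m h) hm.1

theorem hasOrder_of_ne_zero {f : LaurentSeries ℂ} (hf : f ≠ 0) : HasOrder f (-f.order) := by
  refine ⟨?_, fun m hm => ?_⟩
  · rw [zcoeff, neg_neg]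
    exact mt HahnSeries.coeff_order_eq_zero.1 hf
  · exact HahnSeries.coeff_eq_zero_of_lt_order (by omega)

theorem HasOrder.mul_self {f : LaurentSeries ℂ} {n : ℤ} (h : HasOrder f n) :
    HasOrder (f * f) (2 * n) := by
  have h1 := h.unique (hasOrder_of_ne_zero h.ne_zero)
  have h2 := hasOrder_of_ne_zero (mul_ne_zero h.ne_zero h.ne_zero)
  rw [HahnSeries.order_mul h.ne_zero h.ne_zero] at h2
  rwa [show 2 * n = -(f.order + f.order) by omega]

theorem mem_stratumIndex_five {s : ℤ} :
    s ∈ stratumIndex 5 ↔ s = -5 ∨ s = -3 ∨ s = -1 ∨ s = 1 ∨ s ∈ closedOrders := by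
  simp only [stratumIndex, closedOrders, Set.mem_ofPred_eq, Int.even_iff]
  push_cast
  omega

theorem mem_closedOrders {s : ℤ} : s ∈ closedOrders ↔ s = 3 ∨ 5 ≤ s := Iff.rfl

theorem closedOrders_subset : closedOrders ⊆ stratumIndex 5 := fun _ hs =>
  mem_stratumIndex_five.2 (Or.inr (Or.inr (Or.inr (Or.inr hs))))

/-- If f has order n then f² has order 2n, and the excluded orders -5, -3, -1, 1 double to -10, -6,
-2, 2, none of which is in S_5. -/
theorem closed_orders {W V : Submodule ℂ (LaurentSeries ℂ)} (hW : W ∈ stratum 5) (hVW : V ≤ W)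
    (hV : MulClosed V) {f : LaurentSeries ℂ} (hf : f ∈ V) {n : ℤ} (hn : HasOrder f n) :
    n ∈ closedOrders := by
  have h1 : n ∈ stratumIndex 5 := hW.2 ▸ ⟨f, hVW hf, hn⟩
  have h2 : 2 * n ∈ stratumIndex 5 := hW.2 ▸ ⟨f * f, hVW (hV f hf f hf), hn.mul_self⟩
  rw [mem_stratumIndex_five] at h1 h2
  rw [mem_closedOrders] at *
  omega

/-- `f = z^n` plus lower powers. -/
def IsMonicOfOrder (f : LaurentSeries ℂ) (n : ℤ) : Prop :=
  zcoeff f n = 1 ∧ ∀ m : ℤ, n < m → zcoeff f m = 0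

theorem IsMonicOfOrder.hasOrder {f : LaurentSeries ℂ} {n : ℤ} (h : IsMonicOfOrder f n) :
    HasOrder f n :=
  ⟨by rw [h.1]; exact one_ne_zero, h.2⟩

/-- Elimination of leading terms. -/
theorem le_span_of_orders {V : Submodule ℂ (LaurentSeries ℂ)} {p : ℤ → LaurentSeries ℂ}
    (hp : ∀ s ∈ closedOrders, IsMonicOfOrder (p s) s)
    (hV : ∀ f ∈ V, ∀ n, HasOrder f n → n ∈ closedOrders)
    (hpV : Submodule.span ℂ (p '' closedOrders) ≤ V) :
    V ≤ Submodule.span ℂ (p '' closedOrders) := by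
  have key : ∀ N : ℕ, ∀ f ∈ V, (∀ m : ℤ, N ≤ m → zcoeff f m = 0) →
      f ∈ Submodule.span ℂ (p '' closedOrders) := by
    intro N
    induction N with
    | zero =>
      intro f hf h
      by_cases hf0 : f = 0
      · rw [hf0]; exact zero_mem _
      have ho := hasOrder_of_ne_zero hf0
      have hmem := hV f hf _ ho
      rw [mem_closedOrders] at hmem
      exact absurd (h _ (by omega)) ho.1
    | succ N ih =>
      intro f hf h
      by_cases h0 : zcoeff f N = 0
      · refine ih f hf fun m hm => ?_
        rcases hm.eq_or_lt with rfl | hm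
        · exact h0
        · exact h m (by push_cast; omega)
      · have hN : (N : ℤ) ∈ closedOrders :=
          hV f hf N ⟨h0, fun m hm => h m (by push_cast; omega)⟩
        have hpN : p N ∈ Submodule.span ℂ (p '' closedOrders) :=
          Submodule.subset_span ⟨_, hN, rfl⟩
        have hsub : f - zcoeff f N • p N ∈ Submodule.span ℂ (p '' closedOrders) := by
          refine ih _ (sub_mem hf (Submodule.smul_mem _ _ (hpV hpN))) fun m hm => ?_
          rw [zcoeff_sub, zcoeff_smul]
          rcases hm.eq_or_lt with rfl | hm
          · rw [(hp _ hN).1, mul_one, sub_self]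
          · rw [(hp _ hN).2 m hm, h m (by push_cast; omega), mul_zero, sub_zero]
        have := add_mem hsub (Submodule.smul_mem _ (zcoeff f N) hpN)
        rwa [sub_add_cancel] at this
  intro f hf
  by_cases hf0 : f = 0
  · rw [hf0]; exact zero_mem _
  refine key (-f.order + 1).toNat f hf fun m hm => (hasOrder_of_ne_zero hf0).2 m ?_
  omega

theorem IsCanonicalBasis.isMonicOfOrder {m : ℕ} {W : Submodule ℂ (LaurentSeries ℂ)}
    {p : ℤ → LaurentSeries ℂ} (hp : IsCanonicalBasis m W p) {s : ℤ} (hs : s ∈ stratumIndex m) :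
    IsMonicOfOrder (p s) s :=
  ⟨(hp s hs).2.1, (hp s hs).2.2.1⟩

theorem IsCanonicalBasis.span_le {m : ℕ} {W : Submodule ℂ (LaurentSeries ℂ)}
    {p : ℤ → LaurentSeries ℂ} (hp : IsCanonicalBasis m W p) {T : Set ℤ}
    (hT : T ⊆ stratumIndex m) : Submodule.span ℂ (p '' T) ≤ W := by
  rw [Submodule.span_le]
  rintro _ ⟨s, hs, rfl⟩
  exact (hp s (hT hs)).1

theorem maximality {W : Submodule ℂ (LaurentSeries ℂ)} (hW : W ∈ stratum 5)
    {p : ℤ → LaurentSeries ℂ} (hp : IsCanonicalBasis 5 W p) :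
    (∀ T ⊆ stratumIndex 5, MulClosed (Submodule.span ℂ (p '' T)) → T ⊆ closedOrders) ∧
    (MulClosed (Submodule.span ℂ (p '' closedOrders)) →
      ∀ V : Submodule ℂ (LaurentSeries ℂ), V ≤ W → MulClosed V →
        Submodule.span ℂ (p '' closedOrders) ≤ V → V = Submodule.span ℂ (p '' closedOrders)) := by
  refine ⟨fun T hT hmul s hs => ?_, fun _ V hVW hV hle => le_antisymm ?_ hle⟩
  · exact closed_orders hW (hp.span_le hT) hmul (Submodule.subset_span ⟨s, hs, rfl⟩)
      (hp.isMonicOfOrder (hT hs)).hasOrder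
  · exact le_span_of_orders (fun s hs => hp.isMonicOfOrder (closedOrders_subset hs))
      (fun f hf n hn => closed_orders hW hVW hV hf hn) hle

/-- In a finite combination the largest index with nonzero coefficient gives the order, since the
leading exponents are distinct. -/
theorem orders_span {S : Set ℤ} {p : ℤ → LaurentSeries ℂ}
    (hp : ∀ s ∈ S, IsMonicOfOrder (p s) s) :
    {n : ℤ | ∃ f ∈ Submodule.span ℂ (p '' S), HasOrder f n} = S := by
  ext n
  constructor
  · rintro ⟨f, hf, hn⟩
    rw [Set.image_eq_range] at hf
    obtain ⟨c, rfl⟩ := (Finsupp.mem_span_range_iff_exists_finsupp).1 hf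
    have hne : c.support.Nonempty := by
      rw [Finset.nonempty_iff_ne_empty]
      intro h
      exact hn.ne_zero (by rw [Finsupp.sum, h, Finset.sum_empty])
    set s := c.support.max' hne with hs
    have hsc : s ∈ c.support := c.support.max'_mem hne
    have ho : HasOrder (c.sum fun i a => a • p i) s := by
      refine ⟨?_, fun m hm => ?_⟩
      · rw [Finsupp.sum, zcoeff_sum, Finset.sum_eq_single s]
        · rw [zcoeff_smul, (hp _ s.2).1, mul_one]
          exact Finsupp.mem_support_iff.1 hsc
        · intro i hi his
          have : i < s := lt_of_le_of_ne (c.support.le_max' i hi) his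
          rw [zcoeff_smul, (hp _ i.2).2 s this, mul_zero]
        · exact fun h => absurd hsc h
      · rw [Finsupp.sum, zcoeff_sum]
        refine Finset.sum_eq_zero fun i hi => ?_
        have : i ≤ s := c.support.le_max' i hi
        rw [zcoeff_smul, (hp _ i.2).2 m (lt_of_le_of_lt (by exact_mod_cast this) hm), mul_zero]
    rw [hn.unique ho]
    exact s.2
  · intro hn
    exact ⟨p n, Submodule.subset_span ⟨n, hn, rfl⟩, (hp n hn).hasOrder⟩

/-! ### The family `W_5` -/

theorem image_closedOrders (p : ℤ → LaurentSeries ℂ) :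
    p '' closedOrders = Set.range fun j : Idx => p ((j : ℕ) : ℤ) := by
  ext f
  constructor
  · rintro ⟨s, hs, rfl⟩
    rw [mem_closedOrders] at hs
    exact ⟨⟨s.toNat, by omega⟩, by simp only; congr 1; omega⟩
  · rintro ⟨j, rfl⟩
    have := j.2
    exact ⟨_, by rw [mem_closedOrders]; omega, rfl⟩

/-- The nonnegative integers outside S_5 are 0, 2, 4, exactly the nonnegative exponents that
`series` leaves free below the leading power. -/
theorem IsCanonicalBasis.eq_series {W : Submodule ℂ (LaurentSeries ℂ)}
    {p : ℤ → LaurentSeries ℂ} (hp : IsCanonicalBasis 5 W p) (j : Idx) :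
    series (fun j k => zcoeff (p ((j : ℕ) : ℤ)) (-k)) j = p ((j : ℕ) : ℤ) := by
  have hj := j.2
  have hjS : ((j : ℕ) : ℤ) ∈ closedOrders := by rw [mem_closedOrders]; omega
  obtain ⟨-, h1, hgt, hlt⟩ := hp _ (closedOrders_subset hjS)
  refine zcoeff_ext fun n => ?_
  rw [zcoeff_series]
  by_cases hneg : n < 0
  · rw [if_pos hneg, if_neg (by omega), if_neg (by omega), if_neg (by omega), if_neg (by omega)]
    simp
  rw [if_neg hneg]
  by_cases h4 : n = 4
  · subst h4; rw [if_neg (by omega)]; simp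
  by_cases h2 : n = 2
  · subst h2; rw [if_neg (by omega)]; simp
  by_cases h0 : n = 0
  · subst h0; rw [if_neg (by omega)]; simp
  rw [if_neg h4, if_neg h2, if_neg h0]
  by_cases hn : n = ((j : ℕ) : ℤ)
  · subst hn; rw [h1]; simp
  rw [if_neg hn]
  rcases lt_or_gt_of_ne hn with h | h
  · rw [hlt n (mem_stratumIndex_five.2 (by rw [mem_closedOrders]; omega)) (by omega) h]
    simp
  · rw [hgt n h]; simp

theorem exists_constraints_of_mem_W5 {U : Submodule ℂ (LaurentSeries ℂ)} (hU : U ∈ W5) :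
    ∃ E : Idx → Fin 3 → ℂ, Constraints E ∧ U = laurentSpan E := by
  obtain ⟨hmul, hsq, W, hW, p, hp, rfl⟩ := hU
  have hser : series (fun j k => zcoeff (p ((j : ℕ) : ℤ)) (-k)) =
      fun j : Idx => p ((j : ℕ) : ℤ) := funext hp.eq_series
  -- Here H^3_{-4} is the coefficient of z⁴ in p_3, which has order 3.
  have hH : (fun (j : Idx) k => zcoeff (p ((j : ℕ) : ℤ)) (-k)) i3 (-4) = 0 := by
    have h3 : (3 : ℤ) ∈ stratumIndex 5 := closedOrders_subset (Or.inl rfl)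
    exact (hp 3 h3).2.2.1 4 (by norm_num)
  rw [image_closedOrders, ← hser] at hmul hsq ⊢
  refine ⟨_, constraints_evenPart hH hmul hsq, ?_⟩
  rw [series_eq_polyToLaurent (negative_eq_zero hH hmul hsq)]
  rfl

/-- A canonical basis of a point of `Σ_5` that contains `p_3, p_5, p_6, …`: it is completed by
`z⁻⁸ p_3, z⁻⁶ p_3, z⁻⁴ p_3, z⁻² p_3`. -/
def stratumBasis (E : Idx → Fin 3 → ℂ) (s : ℤ) : LaurentSeries ℂ :=
  if h : 3 ≤ s ∧ s ≠ 4 then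
    polyToLaurent (genPoly E ⟨s.toNat, by omega⟩)
  else HahnSeries.single (-(s - 3)) 1 * polyToLaurent (genPoly E i3)

theorem stratumBasis_idx (E : Idx → Fin 3 → ℂ) (j : Idx) :
    stratumBasis E ((j : ℕ) : ℤ) = polyToLaurent (genPoly E j) := by
  have := j.2
  rw [stratumBasis, dif_pos (by omega)]
  rfl

theorem exists_idx {s : ℤ} (hs : s ∈ closedOrders) : ∃ j : Idx, s = ((j : ℕ) : ℤ) := by
  rw [mem_closedOrders] at hs
  exact ⟨⟨s.toNat, by omega⟩, by simp only; omega⟩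

theorem zcoeff_stratumBasis_of_lt (E : Idx → Fin 3 → ℂ) {s : ℤ} (hs : s < 3) (n : ℤ) :
    zcoeff (stratumBasis E s) n = zcoeff (polyToLaurent (genPoly E i3)) (n - (s - 3)) := by
  rw [stratumBasis, dif_neg (by omega), zcoeff_single_mul]

theorem span_stratumBasis_closedOrders (E : Idx → Fin 3 → ℂ) :
    Submodule.span ℂ (stratumBasis E '' closedOrders) = laurentSpan E := by
  rw [image_closedOrders]
  simp only [stratumBasis_idx]
  rfl

theorem isMonicOfOrder_stratumBasis {E : Idx → Fin 3 → ℂ} (hE : Constraints E) {s : ℤ}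
    (hs : s ∈ stratumIndex 5) : IsMonicOfOrder (stratumBasis E s) s := by
  have h3 : E i3 2 = 0 := ((constraints_iff E).1 hE).1
  have key : ∀ j : Idx, IsMonicOfOrder (polyToLaurent (genPoly E j)) ((j : ℕ) : ℤ) := fun j => by
    have hj := j.2
    refine ⟨?_, fun m hm => ?_⟩
    · rw [zcoeff_genPoly, if_pos rfl, if_neg (by omega), if_neg (by omega), if_neg (by omega)]
      simp
    · rw [zcoeff_genPoly, if_neg (by omega), if_neg (by omega : ¬m = 2),
        if_neg (by omega : ¬m = 0)]
      by_cases h : j = i3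
      · simp [h, h3]
      · have : (j : ℕ) ≠ 3 := fun h' => h (Subtype.ext h')
        rw [if_neg (by omega)]
        simp
  rw [mem_stratumIndex_five] at hs
  by_cases hc : s ∈ closedOrders
  · obtain ⟨j, rfl⟩ := exists_idx hc
    rw [stratumBasis_idx]
    exact key j
  · have hlt : s < 3 := by rw [mem_closedOrders] at hc hs; omega
    refine ⟨?_, fun m hm => ?_⟩
    · rw [zcoeff_stratumBasis_of_lt E hlt, show s - (s - 3) = ((i3 : ℕ) : ℤ) by simp [i3]]
      exact (key i3).1
    · rw [zcoeff_stratumBasis_of_lt E hlt]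
      exact (key i3).2 _ (by simp only [i3]; push_cast; omega)

/-- The added vectors z⁻⁸p_3, …, z⁻²p_3 form a chain under z² that ends in p_3; the remaining
vectors span a space already stable. -/
theorem sqInvariant_span_stratumBasis {E : Idx → Fin 3 → ℂ} (hE : Constraints E) :
    SqInvariant (Submodule.span ℂ (stratumBasis E '' stratumIndex 5)) := by
  intro f hf
  induction hf using Submodule.span_induction with
  | zero => rw [mul_zero]; exact zero_mem _
  | add x y _ _ hx hy => rw [mul_add]; exact add_mem hx hy
  | smul c x _ hx =>
    rw [← HahnSeries.C_mul_eq_smul, mul_left_comm, HahnSeries.C_mul_eq_smul]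
    exact Submodule.smul_mem _ _ hx
  | mem x hx =>
    obtain ⟨s, hs, rfl⟩ := hx
    by_cases hc : s ∈ closedOrders
    · have h1 : stratumBasis E s ∈ laurentSpan E := by
        rw [← span_stratumBasis_closedOrders]
        exact Submodule.subset_span ⟨s, hc, rfl⟩
      have h2 := sqInvariant_laurentSpan hE _ h1
      rw [← span_stratumBasis_closedOrders] at h2
      exact Submodule.span_mono (Set.image_mono closedOrders_subset) h2
    · rw [mem_stratumIndex_five, mem_closedOrders] at hs
      rw [mem_closedOrders] at hc
      refine Submodule.subset_span ⟨s + 2, ?_, zcoeff_ext fun n => ?_⟩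
      · rw [mem_stratumIndex_five, mem_closedOrders]; omega
      · rw [zcoeff_z_pow_mul, zcoeff_stratumBasis_of_lt E (s := s) (by omega)]
        by_cases h1 : s = 1
        · subst h1
          have := stratumBasis_idx E i3
          rw [show ((i3 : ℕ) : ℤ) = 1 + 2 from rfl] at this
          rw [this]
          congr 1; push_cast; ring
        · rw [zcoeff_stratumBasis_of_lt E (by omega)]
          congr 1; push_cast; ring

theorem laurentSpan_mem_W5 {E : Idx → Fin 3 → ℂ} (hE : Constraints E) : laurentSpan E ∈ W5 := by
  refine ⟨mulClosed_laurentSpan hE, sqInvariant_laurentSpan hE,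
    Submodule.span ℂ (stratumBasis E '' stratumIndex 5),
    ⟨sqInvariant_span_stratumBasis hE, orders_span fun s hs => isMonicOfOrder_stratumBasis hE hs⟩,
    stratumBasis E, fun s hs => ⟨Submodule.subset_span ⟨s, hs, rfl⟩,
      (isMonicOfOrder_stratumBasis hE hs).1, (isMonicOfOrder_stratumBasis hE hs).2,
      fun i hi hi0 his => ?_⟩, (span_stratumBasis_closedOrders E).symm⟩
  rw [mem_stratumIndex_five] at hs hi
  -- The least nonnegative element of S_5 is 1, so 0 ≤ i < s forces s > 1; for the added vectors the
  -- condition is empty.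
  have hc : s ∈ closedOrders := by
    rw [mem_closedOrders] at *; omega
  obtain ⟨j, rfl⟩ := exists_idx hc
  rw [mem_closedOrders] at hi
  rw [stratumBasis_idx, zcoeff_genPoly, if_neg (by omega), if_neg (by omega), if_neg (by omega),
    if_neg (by omega)]
  simp

theorem mem_W5_iff (U : Submodule ℂ (LaurentSeries ℂ)) :
    U ∈ W5 ↔ ∃! E : Idx → Fin 3 → ℂ, Constraints E ∧
      U = Submodule.span ℂ (Set.range fun j => polyToLaurent (basisPoly E j)) := by
  constructor
  · intro hU
    obtain ⟨E, hE, rfl⟩ := exists_constraints_of_mem_W5 hU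
    exact ⟨E, ⟨hE, rfl⟩, fun E' h => (laurentSpan_injective h.2).symm⟩
  · rintro ⟨E, ⟨hE, rfl⟩, -⟩
    exact laurentSpan_mem_W5 hE

/-! ### Regular differentials of `ℂ(t)` -/

section Differentials

open Polynomial

/-- It says that t²(p/q)' is bounded at infinity if p/q is. The Wronskian is unchanged when a
multiple of q is subtracted from p, so deg p < deg q may be assumed; a naive degree count would be
one too large. -/
theorem natDegree_wronskian_mul_X_sq_le {p q : ℂ[X]} (hq : q ≠ 0)
    (hpq : p.natDegree ≤ q.natDegree) :
    ((q * derivative p - p * derivative q) * X ^ 2).natDegree ≤ (q ^ 2).natDegree := by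
  obtain ⟨c, hc⟩ : ∃ c : ℂ, (p - C c * q).degree < q.degree := by
    by_cases h : p.degree < q.degree
    · exact ⟨0, by simpa using h⟩
    · have hp : p ≠ 0 := by
        rintro rfl
        exact h (by simpa [bot_lt_iff_ne_bot] using hq)
      have hle : p.degree ≤ q.degree := by
        rw [degree_eq_natDegree hp, degree_eq_natDegree hq]; exact_mod_cast hpq
      have hd : p.degree = q.degree := le_antisymm hle (not_lt.1 h)
      have hlq : q.leadingCoeff ≠ 0 := leadingCoeff_ne_zero.2 hq
      have hlp : p.leadingCoeff ≠ 0 := leadingCoeff_ne_zero.2 hp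
      refine ⟨p.leadingCoeff / q.leadingCoeff, ?_⟩
      rw [← hd]
      refine degree_sub_lt_left ?_ hp ?_
      · rw [degree_C_mul (div_ne_zero hlp hlq), hd]
      · rw [leadingCoeff_mul, leadingCoeff_C, div_mul_cancel₀ _ hlq]
  set r := p - C c * q with hr
  have hw : q * derivative p - p * derivative q = q * derivative r - r * derivative q := by
    rw [hr, derivative_sub, derivative_mul, derivative_C]; ring
  rw [hw, natDegree_pow, sub_mul]
  by_cases hr0 : r = 0
  · simp [hr0]
  have hlt : r.natDegree < q.natDegree := natDegree_lt_natDegree hr0 hc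
  have h1 : (q * derivative r * X ^ 2).natDegree ≤ 2 * q.natDegree := by
    by_cases h0 : r.natDegree = 0
    · rw [eq_C_of_natDegree_eq_zero h0]; simp
    · have h2 := natDegree_derivative_le r
      have h3 := natDegree_mul_le (p := q * derivative r) (q := X ^ 2)
      have h4 := natDegree_mul_le (p := q) (q := derivative r)
      rw [natDegree_X_pow] at h3
      omega
  have h2 : (r * derivative q * X ^ 2).natDegree ≤ 2 * q.natDegree := by
    have h2 := natDegree_derivative_le q
    have h3 := natDegree_mul_le (p := r * derivative q) (q := X ^ 2)
    have h4 := natDegree_mul_le (p := r) (q := derivative q)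
    rw [natDegree_X_pow] at h3
    omega
  exact (natDegree_sub_le _ _).trans (max_le h1 h2)

variable {F : Type*} [Field F] [Algebra ℂ F]

/-- Regularity at a place is thus tested against one generator u: dt at finite places, t⁻² dt at
infinity. -/
theorem mem_smul_of_mem_span (A : ValuationSubring F) {u ω : Ω[F⁄ℂ]}
    (hu : ∀ x ∈ A, ∃ g ∈ A, KaehlerDifferential.D ℂ F x = g • u)
    (hω : ω ∈ Submodule.span A.toSubring
      (Set.range fun x : A => KaehlerDifferential.D ℂ F (x : F))) :
    ∃ g ∈ A, ω = g • u := by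
  induction hω using Submodule.span_induction with
  | mem x hx =>
    obtain ⟨y, rfl⟩ := hx
    exact hu y y.2
  | zero => exact ⟨0, A.zero_mem, by simp⟩
  | add x y _ _ hx hy =>
    obtain ⟨g, hg, rfl⟩ := hx
    obtain ⟨h, hh, rfl⟩ := hy
    exact ⟨g + h, A.add_mem _ _ hg hh, by rw [add_smul]⟩
  | smul c x _ hx =>
    obtain ⟨g, hg, rfl⟩ := hx
    exact ⟨c * g, A.mul_mem _ _ c.2 hg, by rw [mul_smul]; rfl⟩

theorem derivation_div_aeval (t : F) (p q : ℂ[X]) :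
    KaehlerDifferential.D ℂ F (aeval t p / aeval t q) =
      (aeval t (q * derivative p - p * derivative q) / aeval t (q ^ 2)) •
        KaehlerDifferential.D ℂ F t := by
  rw [Derivation.leibniz_div, Derivation.map_aeval, Derivation.map_aeval, smul_smul, smul_smul,
    ← sub_smul, smul_smul]
  congr 1
  simp only [map_sub, map_mul, map_pow]
  rw [inv_pow, div_eq_inv_mul]

/-- The place `t = c` of `ℂ(t)`. -/
def finitePlace (c : ℂ) : IsDedekindDomain.HeightOneSpectrum ℂ[X] where
  asIdeal := Ideal.span {X - C c}
  isPrime := (Ideal.span_singleton_prime (X_sub_C_ne_zero c)).2 (prime_X_sub_C c)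
  ne_bot := by simpa using X_sub_C_ne_zero c

theorem mem_finitePlace {c : ℂ} {p : ℂ[X]} : p ∈ (finitePlace c).asIdeal ↔ p.IsRoot c := by
  rw [finitePlace, Ideal.mem_span_singleton, dvd_iff_isRoot]

theorem denom_isRoot_imp (x : RatFunc ℂ) (c : ℂ) :
    x.denom ∈ (finitePlace c).asIdeal → x.num ∉ (finitePlace c).asIdeal := by
  rw [mem_finitePlace, mem_finitePlace]
  intro hd hn
  obtain ⟨a, b, hab⟩ := x.isCoprime_num_denom
  have := congrArg (eval c) hab
  rw [eval_add, eval_mul, eval_mul, hd.eq_zero, hn.eq_zero] at this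
  simp at this

theorem valuation_finitePlace_le_one_iff (x : RatFunc ℂ) (c : ℂ) :
    (finitePlace c).valuation (RatFunc ℂ) x ≤ 1 ↔ ¬ x.denom.IsRoot c := by
  conv_lhs => rw [← x.num_div_denom]
  rw [IsDedekindDomain.HeightOneSpectrum.valuation_div_le_one_iff _ _ _ x.denom_ne_zero
    (denom_isRoot_imp x c), mem_finitePlace]

/-- The denominator has no root in ℂ, so it is constant, and it is monic. -/
theorem exists_polynomial_of_valuation_le_one {x : RatFunc ℂ}
    (h : ∀ c, (finitePlace c).valuation (RatFunc ℂ) x ≤ 1) :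
    ∃ p : ℂ[X], x = algebraMap ℂ[X] (RatFunc ℂ) p := by
  have hd : x.denom.degree = 0 := by
    by_contra h0
    obtain ⟨c, hc⟩ := IsAlgClosed.exists_root x.denom h0
    exact (valuation_finitePlace_le_one_iff x c).1 (h c) hc
  have h1 : x.denom = 1 := by
    rw [eq_C_of_degree_eq_zero hd]
    have := x.monic_denom
    rw [eq_C_of_degree_eq_zero hd, Monic, leadingCoeff_C] at this
    rw [this, map_one]
  exact ⟨x.num, by conv_lhs => rw [← x.num_div_denom, h1, map_one, div_one]⟩

open scoped Classical in
theorem inftyValuation_algebraMap {p : ℂ[X]} (hp : p ≠ 0) :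
    RatFunc.inftyValuation ℂ (algebraMap ℂ[X] (RatFunc ℂ) p) =
      WithZero.exp (p.natDegree : ℤ) :=
  RatFunc.inftyValuation.polynomial ℂ hp

open scoped Classical in
theorem inftyValuation_div_le_one_iff {p q : ℂ[X]} (hp : p ≠ 0) (hq : q ≠ 0) :
    RatFunc.inftyValuation ℂ (algebraMap ℂ[X] (RatFunc ℂ) p / algebraMap ℂ[X] (RatFunc ℂ) q) ≤ 1 ↔
      p.natDegree ≤ q.natDegree := by
  rw [map_div₀, inftyValuation_algebraMap hp, inftyValuation_algebraMap hq, ← WithZero.exp_sub,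
    ← WithZero.exp_zero, WithZero.exp_le_exp]
  omega

open scoped Classical in
-- Every differential is f dt. Regularity at the finite places makes f a polynomial, and at infinity
-- it makes t² f bounded, so f = 0.
theorem regularDifferentials_eq_bot (e : F ≃ₐ[ℂ] RatFunc ℂ) : regularDifferentials ℂ F = ⊥ := by
  set t : F := e.symm RatFunc.X with ht
  have het : ∀ p : ℂ[X], e (aeval t p) = algebraMap ℂ[X] (RatFunc ℂ) p := fun p => by
    rw [← aeval_algHom_apply e t p, ht, AlgEquiv.apply_symm_apply, RatFunc.aeval_X_left_eq_algebraMap]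
  have ht0 : t ≠ 0 := by
    rw [ht]; simp [RatFunc.X_ne_zero]
  have hx : ∀ x : F, x = aeval t (e x).num / aeval t (e x).denom := fun x => by
    apply e.injective
    rw [map_div₀, het, het, RatFunc.num_div_denom]
  have hD : ∀ x : F, KaehlerDifferential.D ℂ F x =
      (aeval t ((e x).denom * derivative (e x).num - (e x).num * derivative (e x).denom) /
        aeval t ((e x).denom ^ 2)) • KaehlerDifferential.D ℂ F t := fun x => by
    conv_lhs => rw [hx x]
    exact derivation_div_aeval t _ _
  have hΩ : ∀ ω : Ω[F⁄ℂ], ∃ f : F, ω = f • KaehlerDifferential.D ℂ F t := fun ω => by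
    have hω : ω ∈ Submodule.span F (Set.range (KaehlerDifferential.D ℂ F)) := by
      rw [KaehlerDifferential.span_range_derivation]; trivial
    have hle : Submodule.span F (Set.range (KaehlerDifferential.D ℂ F)) ≤
        Submodule.span F {KaehlerDifferential.D ℂ F t} := by
      rw [Submodule.span_le]
      rintro _ ⟨x, rfl⟩
      rw [hD x]
      exact Submodule.smul_mem _ _ (Submodule.mem_span_singleton_self _)
    obtain ⟨f, hf⟩ := Submodule.mem_span_singleton.1 (hle hω)
    exact ⟨f, hf.symm⟩
  rw [eq_bot_iff]
  intro ω hω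
  rw [Submodule.mem_bot]
  obtain ⟨f, rfl⟩ := hΩ ω
  by_cases hdt : KaehlerDifferential.D ℂ F t = 0
  · rw [hdt, smul_zero]
  have hinj : ∀ {x y : F}, x • KaehlerDifferential.D ℂ F t = y • KaehlerDifferential.D ℂ F t →
      x = y := fun h => smul_left_injective F hdt h
  -- regularity at the finite places
  have hfin : ∀ c, (finitePlace c).valuation (RatFunc ℂ) (e f) ≤ 1 := fun c => by
    let A : ValuationSubring F :=
      ((finitePlace c).valuation (RatFunc ℂ)).valuationSubring.comap (e : F →+* RatFunc ℂ)
    have hA : ∀ y : F, y ∈ A ↔ (finitePlace c).valuation (RatFunc ℂ) (e y) ≤ 1 := fun y => Iff.rfl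
    have hAp : ∀ p : ℂ[X], aeval t p ∈ A := fun p => by
      rw [hA, het]
      exact (finitePlace c).valuation_le_one p
    have hAc : ∀ a : ℂ, algebraMap ℂ F a ∈ A := fun a => by
      have := hAp (C a)
      rwa [aeval_C] at this
    have hu : ∀ x ∈ A, ∃ g ∈ A,
        KaehlerDifferential.D ℂ F x = g • KaehlerDifferential.D ℂ F t := fun x hxA => by
      refine ⟨_, ?_, hD x⟩
      have hr := (valuation_finitePlace_le_one_iff (e x) c).1 ((hA x).1 hxA)
      rw [hA, map_div₀, het, het, map_pow, map_div₀, map_pow,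
        (IsDedekindDomain.HeightOneSpectrum.valuation_eq_one_iff_notMem (v := finitePlace c)
          (K := RatFunc ℂ) (r := (e x).denom)).2 (by rwa [mem_finitePlace]), one_pow, div_one]
      exact (finitePlace c).valuation_le_one _
    obtain ⟨g, hg, hfg⟩ := mem_smul_of_mem_span A hu (hω A hAc)
    rw [hinj hfg]
    exact hg
  obtain ⟨P, hP⟩ := exists_polynomial_of_valuation_le_one hfin
  by_cases hP0 : P = 0
  · have : f = 0 := by
      apply e.injective
      rw [hP, hP0, map_zero, map_zero]
    rw [this, zero_smul]
  -- regularity at infinity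
  exfalso
  let A : ValuationSubring F :=
    (RatFunc.inftyValuation ℂ).valuationSubring.comap (e : F →+* RatFunc ℂ)
  have hA : ∀ y : F, y ∈ A ↔ RatFunc.inftyValuation ℂ (e y) ≤ 1 := fun y => Iff.rfl
  have hAc : ∀ a : ℂ, algebraMap ℂ F a ∈ A := fun a => by
    rw [hA, ← aeval_C t a, het]
    by_cases ha : a = 0
    · simp [ha]
    · rw [inftyValuation_algebraMap (by simpa using ha), natDegree_C]; simp
  have hX : aeval t (X ^ 2 : ℂ[X]) ≠ 0 := by simpa using ht0
  -- The generator at infinity is t⁻² dt = -d(1/t).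
  have hu : ∀ x ∈ A, ∃ g ∈ A, KaehlerDifferential.D ℂ F x =
      g • (aeval t (X ^ 2 : ℂ[X]))⁻¹ • KaehlerDifferential.D ℂ F t := fun x hxA => by
    have hd0 := (e x).denom_ne_zero
    refine ⟨aeval t (((e x).denom * derivative (e x).num - (e x).num * derivative (e x).denom)
      * X ^ 2) / aeval t ((e x).denom ^ 2), ?_, ?_⟩
    · rw [hA, map_div₀, het, het]
      by_cases hw : ((e x).denom * derivative (e x).num - (e x).num * derivative (e x).denom)
          * X ^ 2 = 0
      · rw [hw]; simp
      rw [inftyValuation_div_le_one_iff hw (pow_ne_zero _ hd0)]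
      apply natDegree_wronskian_mul_X_sq_le hd0
      by_cases hn : (e x).num = 0
      · rw [hn]; simp
      rw [hA, ← (e x).num_div_denom, inftyValuation_div_le_one_iff hn hd0] at hxA
      exact hxA
    · rw [hD x, smul_smul, map_mul]
      congr 1
      field_simp
  obtain ⟨g, hg, hfg⟩ := mem_smul_of_mem_span A hu (hω A hAc)
  rw [smul_smul] at hfg
  have hfg := hinj hfg
  have hg' : g = aeval t (P * X ^ 2) := by
    have hfP : f = aeval t P := e.injective (by rw [hP, het])
    rw [map_mul, ← hfP, hfg, mul_assoc, inv_mul_cancel₀ hX, mul_one]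
  rw [hA, hg', het, inftyValuation_algebraMap (by simpa using hP0), ← WithZero.exp_zero,
    WithZero.exp_le_exp, natDegree_mul hP0 (by simp), natDegree_X_pow] at hg
  push_cast at hg
  omega

end Differentials

/-! ### Plane curves with a polynomial parametrization -/

section Parametrization

open Polynomial

/-- The nonzero terms r_i(P) Q^i have degrees congruent to i deg Q modulo deg P. For i < deg P these
are distinct by coprimality, so the terms cannot cancel. -/
theorem sum_comp_mul_pow_eq_zero {P Q : ℂ[X]} (hP : 0 < P.natDegree)
    (hPQ : P.natDegree.Coprime Q.natDegree) {r : ℂ[X][X]} (hr : r.degree < P.natDegree)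
    (h : eval₂ (compRingHom P) Q r = 0) : r = 0 := by
  by_contra hr0
  rw [eval₂_eq_sum, sum_def] at h
  have hterm : ∀ i ∈ r.support, i < P.natDegree := fun i hi =>
    by exact_mod_cast (le_degree_of_mem_supp i hi).trans_lt hr
  have hcomp : ∀ i ∈ r.support, (r.coeff i).comp P ≠ 0 := fun i hi h0 => by
    rw [comp_eq_zero_iff] at h0
    rcases h0 with h0 | ⟨-, h0⟩
    · exact mem_support_iff.1 hi h0
    · rw [h0, natDegree_C] at hP
      exact lt_irrefl _ hP
  have hdeg := degree_sum_eq_of_disjoint (fun i => compRingHom P (r.coeff i) * Q ^ i) r.support (by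
    rintro i ⟨hi, hi0⟩ j ⟨hj, hj0⟩ hij heq
    simp only [Function.comp] at heq
    have hnat := natDegree_eq_of_degree_eq heq
    rw [natDegree_mul (left_ne_zero_of_mul hi0) (right_ne_zero_of_mul hi0),
      natDegree_mul (left_ne_zero_of_mul hj0) (right_ne_zero_of_mul hj0), natDegree_pow,
      natDegree_pow, coe_compRingHom_apply, coe_compRingHom_apply, natDegree_comp,
      natDegree_comp] at hnat
    have hmod : i * Q.natDegree ≡ j * Q.natDegree [MOD P.natDegree] := by
      have h1 : (r.coeff i).natDegree * P.natDegree + i * Q.natDegree ≡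
          (r.coeff j).natDegree * P.natDegree + j * Q.natDegree [MOD P.natDegree] := by
        rw [hnat]
      simpa [Nat.ModEq] using h1
    have := Nat.ModEq.cancel_right_of_coprime hPQ hmod
    exact hij (Nat.ModEq.eq_of_lt_of_lt this (hterm i hi) (hterm j hj)))
  rw [h, degree_zero] at hdeg
  obtain ⟨i, hi⟩ := nonempty_support_iff.2 hr0
  have h1 := Finset.le_sup (f := fun i => degree (compRingHom P (r.coeff i) * Q ^ i)) hi
  rw [← hdeg, le_bot_iff, degree_eq_bot, mul_eq_zero] at h1
  rcases h1 with h1 | h1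
  · exact hcomp i hi h1
  · by_cases h0 : i = 0
    · simp [h0] at h1
    -- If Q = 0, coprimality gives deg P = 1, which leaves only i = 0.
    · have hQ : Q = 0 := by simpa [h0] using h1
      rw [hQ, natDegree_zero, Nat.coprime_zero_right] at hPQ
      have := hterm i hi
      omega

/-- The identification of `ℂ[x][y]` with the polynomials in two variables. -/
def bivariate : ℂ[X][X] →+* MvPolynomial (Fin 2) ℂ :=
  eval₂RingHom (aeval (MvPolynomial.X 0 : MvPolynomial (Fin 2) ℂ)).toRingHom (MvPolynomial.X 1)

theorem bivariate_CC (a : ℂ) : bivariate (C (C a)) = MvPolynomial.C a := by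
  simp [bivariate, MvPolynomial.algebraMap_eq]

theorem bivariate_CX : bivariate (C X) = MvPolynomial.X 0 := by simp [bivariate]

theorem bivariate_X : bivariate X = MvPolynomial.X 1 := by simp [bivariate]

theorem bivariate_surjective : Function.Surjective bivariate := fun f => by
  induction f using MvPolynomial.induction_on with
  | C a => exact ⟨C (C a), bivariate_CC a⟩
  | add f g hf hg =>
    obtain ⟨F, rfl⟩ := hf
    obtain ⟨G, rfl⟩ := hg
    exact ⟨F + G, map_add _ _ _⟩
  | mul_X f i hf =>
    obtain ⟨F, rfl⟩ := hf
    fin_cases i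
    · exact ⟨F * C X, by rw [map_mul, bivariate_CX]; rfl⟩
    · exact ⟨F * X, by rw [map_mul, bivariate_X]; rfl⟩

theorem bivariate_injective : Function.Injective bivariate := by
  let χ : MvPolynomial (Fin 2) ℂ →+* ℂ[X][X] :=
    MvPolynomial.eval₂Hom ((C : ℂ[X] →+* ℂ[X][X]).comp C) ![C X, X]
  have h : χ.comp bivariate = RingHom.id _ := by
    apply Polynomial.ringHom_ext'
    · apply Polynomial.ringHom_ext'
      · ext a
        simp [bivariate_CC, χ]
      · simp [bivariate_CX, χ]
    · simp [bivariate_X, χ]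
  exact Function.LeftInverse.injective (g := χ) fun F => RingHom.congr_fun h F

theorem aeval_bivariate (P Q : ℂ[X]) (F : ℂ[X][X]) :
    MvPolynomial.aeval ![P, Q] (bivariate F) = eval₂ (compRingHom P) Q F := by
  have h : (MvPolynomial.aeval (R := ℂ) ![P, Q]).toRingHom.comp bivariate =
      eval₂RingHom (compRingHom P) Q := by
    apply Polynomial.ringHom_ext'
    · apply Polynomial.ringHom_ext'
      · ext a : 1
        simp [bivariate_CC, Polynomial.algebraMap_eq]
      · simp [bivariate_CX]
    · simp [bivariate_X]
  exact RingHom.congr_fun h F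

/-- The kernel of a polynomial parametrization `(P, Q)` of coprime degrees is generated by any
relation that is monic in `y` of degree `deg P`. -/
theorem ker_parametrization {P Q : ℂ[X]} (hP : 0 < P.natDegree)
    (hPQ : P.natDegree.Coprime Q.natDegree) {F : ℂ[X][X]} (hF : F.Monic)
    (hFd : F.natDegree = P.natDegree) (h0 : MvPolynomial.aeval ![P, Q] (bivariate F) = 0) :
    RingHom.ker (MvPolynomial.aeval (R := ℂ) ![P, Q]) = Ideal.span {bivariate F} := by
  apply le_antisymm
  · intro g hg
    obtain ⟨G, rfl⟩ := bivariate_surjective g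
    have hdiv := modByMonic_add_div G F
    have hr : G %ₘ F = 0 := by
      apply sum_comp_mul_pow_eq_zero hP hPQ
      · rw [← hFd, ← degree_eq_natDegree hF.ne_zero]
        exact degree_modByMonic_lt G hF
      · rw [← aeval_bivariate]
        have : MvPolynomial.aeval ![P, Q] (bivariate (G %ₘ F + F * (G /ₘ F))) = 0 := by
          rw [hdiv]; exact hg
        rwa [map_add, map_add, map_mul, map_mul, h0, zero_mul, add_zero] at this
    rw [← hdiv, hr, zero_add, map_mul]
    exact Ideal.mul_mem_right _ _ (Ideal.mem_span_singleton_self _)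
  · rw [Ideal.span_singleton_le_iff_mem]
    exact h0

/-- The coordinate ring embeds in ℂ[t], hence its fraction field in ℂ(t); the image contains t =
g/h, so it is everything. -/
theorem rational_of_parametrization {P Q : ℂ[X]} {f : MvPolynomial (Fin 2) ℂ} (hf0 : f ≠ 0)
    (hker : RingHom.ker (MvPolynomial.aeval (R := ℂ) ![P, Q]) = Ideal.span {f})
    (g h : MvPolynomial (Fin 2) ℂ) (hh : MvPolynomial.aeval ![P, Q] h ≠ 0)
    (hgh : X * MvPolynomial.aeval ![P, Q] h = MvPolynomial.aeval ![P, Q] g) :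
    IsRationalCurve f ∧ HasGenus f 0 := by
  let φ : CoordRing f →ₐ[ℂ] ℂ[X] := Ideal.Quotient.liftₐ (Ideal.span {f})
    (MvPolynomial.aeval (R := ℂ) ![P, Q]) fun x hx => by
      rw [← hker] at hx; exact hx
  have hφ : Function.Injective φ := by
    rw [injective_iff_map_eq_zero]
    intro x hx
    obtain ⟨x, rfl⟩ := Ideal.Quotient.mk_surjective x
    rw [Ideal.Quotient.eq_zero_iff_mem, ← hker]
    exact hx
  have hdom : IsDomain (CoordRing f) := hφ.isDomain φ.toRingHom
  have hprime : Prime f := by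
    rw [← Ideal.span_singleton_prime hf0, ← Ideal.Quotient.isDomain_iff_prime]
    exact hdom
  let ψ : CoordRing f →ₐ[ℂ] RatFunc ℂ := (IsScalarTower.toAlgHom ℂ ℂ[X] (RatFunc ℂ)).comp φ
  have hψ : Function.Injective ψ := (RatFunc.algebraMap_injective ℂ).comp hφ
  let Ψ : FractionRing (CoordRing f) →ₐ[ℂ] RatFunc ℂ := IsFractionRing.liftAlgHom hψ
  have hΨ : ∀ x : MvPolynomial (Fin 2) ℂ,
      Ψ (algebraMap (CoordRing f) _ (Ideal.Quotient.mk _ x)) =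
        algebraMap ℂ[X] (RatFunc ℂ) (MvPolynomial.aeval ![P, Q] x) := fun x =>
    IsFractionRing.lift_algebraMap hψ _
  have hsurj : Function.Surjective Ψ := by
    rw [← AlgHom.fieldRange_eq_top, eq_top_iff, ← RatFunc.adjoin_X,
      IntermediateField.adjoin_simple_le_iff]
    have hh' : algebraMap ℂ[X] (RatFunc ℂ) (MvPolynomial.aeval ![P, Q] h) ≠ 0 := by
      rw [Ne, map_eq_zero_iff _ (RatFunc.algebraMap_injective ℂ)]
      exact hh
    have hX : (RatFunc.X : RatFunc ℂ) =
        Ψ (algebraMap (CoordRing f) _ (Ideal.Quotient.mk _ g)) /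
          Ψ (algebraMap (CoordRing f) _ (Ideal.Quotient.mk _ h)) := by
      rw [hΨ, hΨ, ← hgh, map_mul, RatFunc.algebraMap_X, mul_div_cancel_right₀ _ hh']
    rw [hX]
    exact div_mem ⟨_, rfl⟩ ⟨_, rfl⟩
  let e : FractionRing (CoordRing f) ≃ₐ[ℂ] RatFunc ℂ :=
    AlgEquiv.ofBijective Ψ ⟨Ψ.toRingHom.injective, hsurj⟩
  refine ⟨⟨hprime.irreducible, ⟨e⟩⟩, hdom, ?_⟩
  rw [regularDifferentials_eq_bot e]
  simp

end Parametrization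

/-! ### The two plane curves -/

section Curves

open Polynomial

/-- The polynomial `p_3`. -/
def param3 (a b : ℂ) : ℂ[X] := X ^ 3 + C a * X ^ 2 + C b

/-- The polynomial `p_5`. -/
def param5 (a b : ℂ) : ℂ[X] := X ^ 2 * param3 a b

/-- The polynomial `p_6`. -/
def param6 (a b : ℂ) : ℂ[X] := X ^ 6 - (C a * X ^ 2 + C b) ^ 2

theorem genPoly_solution_i3 (a b : ℂ) : genPoly (solution a b) i3 = param3 a b := by
  rw [genPoly_i3 (constraints_solution a b), solution_i3]; simp [param3]

theorem genPoly_solution_i5 (a b : ℂ) : genPoly (solution a b) i5 = param5 a b := by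
  rw [genPoly_i5 (constraints_solution a b), genPoly_solution_i3, param5]

theorem genPoly_solution_i6 (a b : ℂ) : genPoly (solution a b) i6 = param6 a b := by
  rw [genPoly_i6 (constraints_solution a b), solution_i3]; simp [param6]

theorem curve35_param (a b : ℂ) : curve35 (C a) (C b) (param3 a b) (param5 a b) = 0 := by
  have h := curve35_genPoly (constraints_solution a b)
  rw [genPoly_solution_i3, genPoly_solution_i5, solution_i3] at h
  simpa using h

theorem curve56_param (a b : ℂ) : curve56 (C a) (C b) (param5 a b) (param6 a b) = 0 := by
  have h := curve56_genPoly (constraints_solution a b)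
  rw [genPoly_solution_i5, genPoly_solution_i6, solution_i3] at h
  simpa using h

theorem natDegree_param3 (a b : ℂ) : (param3 a b).natDegree = 3 := by
  rw [param3]; compute_degree!

theorem param3_ne_zero (a b : ℂ) : param3 a b ≠ 0 := fun h => by
  have := natDegree_param3 a b
  rw [h, natDegree_zero] at this
  omega

theorem natDegree_param5 (a b : ℂ) : (param5 a b).natDegree = 5 := by
  rw [param5, natDegree_mul (by simp) (param3_ne_zero a b), natDegree_X_pow, natDegree_param3]

theorem param5_ne_zero (a b : ℂ) : param5 a b ≠ 0 := fun h => by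
  have := natDegree_param5 a b
  rw [h, natDegree_zero] at this
  omega

theorem natDegree_param6 (a b : ℂ) : (param6 a b).natDegree = 6 := by
  have h : param6 a b = X ^ 6 - C (a ^ 2) * X ^ 4 - C (2 * a * b) * X ^ 2 - C (b ^ 2) := by
    simp only [param6, map_mul, map_pow, map_ofNat]; ring
  rw [h]; compute_degree!

theorem monic_natDegree_of_eq {F G : ℂ[X][X]} {n : ℕ} (h : F = X ^ (n + 1) + G)
    (hG : G.natDegree ≤ n) : F.Monic ∧ F.natDegree = n + 1 := by
  have hd : G.degree < ((n + 1 : ℕ) : WithBot ℕ) :=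
    (degree_le_of_natDegree_le hG).trans_lt (by exact_mod_cast Nat.lt_succ_self n)
  refine ⟨h ▸ monic_X_pow_add hd, ?_⟩
  rw [h, natDegree_add_eq_left_of_degree_lt (by rwa [degree_X_pow]), natDegree_X_pow]

theorem rational_plane35 (a b : ℂ) :
    IsRationalCurve (plane35 a b) ∧ HasGenus (plane35 a b) 0 := by
  obtain ⟨hm, hd⟩ := monic_natDegree_of_eq (n := 2)
    (F := curve35 (C (C a)) (C (C b)) (C X) X)
    (G := C (-(C a ^ 2 * X)) * X ^ 2 + C (2 * C a * X ^ 3 - 2 * C b * C a * X ^ 2) * X +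
      C (-X ^ 5 + 2 * C b * X ^ 4 - C b ^ 2 * X ^ 3))
    (by simp only [curve35, map_add, map_sub, map_neg, map_mul, map_pow, map_ofNat]; ring)
    (by compute_degree)
  have hf : bivariate (curve35 (C (C a)) (C (C b)) (C X) X) = plane35 a b := by
    rw [map_curve35, bivariate_CC, bivariate_CC, bivariate_CX, bivariate_X, plane35]
  -- Since p_3² = (t³ + at² + b) p_3 and p_5 = t² p_3, one has t p_5 = p_3² - a p_5 - b p_3.
  refine rational_of_parametrization (P := param3 a b) (Q := param5 a b) ?_ ?_
    (MvPolynomial.X 0 ^ 2 - MvPolynomial.C a * MvPolynomial.X 1 -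
      MvPolynomial.C b * MvPolynomial.X 0) (MvPolynomial.X 1) ?_ ?_
  · rw [← hf, Ne, map_eq_zero_iff _ bivariate_injective]
    exact hm.ne_zero
  · rw [← hf]
    refine ker_parametrization ?_ ?_ hm ?_ ?_
    · rw [natDegree_param3]; norm_num
    · rw [natDegree_param3, natDegree_param5]; norm_num
    · rw [hd, natDegree_param3]
    · rw [hf, plane35, map_curve35, ← curve35_param a b]
      simp [Polynomial.algebraMap_eq]
  · simpa using param5_ne_zero a b
  · simp only [map_sub, map_mul, map_pow, MvPolynomial.aeval_X, MvPolynomial.aeval_C,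
      Polynomial.algebraMap_eq, Matrix.cons_val_zero, Matrix.cons_val_one]
    simp only [param5, param3]
    ring

/-- The numerator of `t` as a rational function of `x = p_5` and `w = p_6 + a p_5`. -/
def numer56 {R : Type*} [CommRing R] (a b x w : R) : R :=
  b * ((w + a * x) * w ^ 2 + 2 * b * x ^ 3) ^ 2 -
    (b * w * (w + a * x) - x ^ 3) *
      (((w + a * x) * w ^ 2 + 2 * b * x ^ 3) * w + b * (w + a * x) * x ^ 3)

/-- The denominator of `t` as a rational function of `x = p_5` and `w = p_6 + a p_5`. -/
def denom56 {R : Type*} [CommRing R] (a b x w : R) : R :=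
  x ^ 4 * (b ^ 2 * (w + a * x) ^ 2 + (w + a * x) * w ^ 2 + 2 * b * x ^ 3)

/-- Put p = p_3, so that x = t² p and w = (t³ - b) p. Then t = (w + bp)/x, and eliminating p between
p² = w + ax + 2bp and p(w + bp)² = x³ shows why t is rational in x and w. -/
theorem X_mul_denom56 (a b : ℂ) :
    X * denom56 (C a) (C b) (param5 a b) (param6 a b + C a * param5 a b) =
      numer56 (C a) (C b) (param5 a b) (param6 a b + C a * param5 a b) := by
  have h5 : param5 a b = X ^ 2 * param3 a b := rfl
  have hw : param6 a b + C a * param5 a b = (X ^ 3 - C b) * param3 a b := by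
    simp only [param6, param5, param3]; ring
  -- Eliminating b uses up the only relation, so the rest is an identity in the independent
  -- quantities p, t, a.
  have h3 : C b = param3 a b - X ^ 3 - C a * X ^ 2 := by rw [param3]; ring
  rw [hw, h5, numer56, denom56]
  generalize param3 a b = p at h3
  rw [h3]
  ring

/-- After p_5⁴ p_3² is factored out, the first summand of the cofactor is monic of degree 12 and the
others have degree at most 9. -/
theorem denom56_ne_zero (a b : ℂ) :
    denom56 (C a) (C b) (param5 a b) (param6 a b + C a * param5 a b) ≠ 0 := by
  have hw : param6 a b + C a * param5 a b = (X ^ 3 - C b) * param3 a b := by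
    simp only [param6, param5, param3]; ring
  have h : denom56 (C a) (C b) (param5 a b) (param6 a b + C a * param5 a b) =
      param5 a b ^ 4 * (param3 a b ^ 2 *
        ((X ^ 3 + C a * X ^ 2 + C b) * (X ^ 3 + C a * X ^ 2 + C (-b)) * (X ^ 3 + C (-b)) ^ 2 +
          (C (2 * b) * X ^ 6 * (X ^ 3 + C a * X ^ 2 + C b) +
            C (b ^ 2) * (X ^ 3 + C a * X ^ 2 + C (-b)) ^ 2))) := by
    rw [denom56, hw, param5, param3]
    simp only [map_neg, map_mul, map_pow, map_ofNat]
    ring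
  have h12 : ((X ^ 3 + C a * X ^ 2 + C b) * (X ^ 3 + C a * X ^ 2 + C (-b)) * (X ^ 3 + C (-b)) ^ 2 +
      (C (2 * b) * X ^ 6 * (X ^ 3 + C a * X ^ 2 + C b) +
        C (b ^ 2) * (X ^ 3 + C a * X ^ 2 + C (-b)) ^ 2)).natDegree = 12 := by
    compute_degree!
  rw [h]
  refine mul_ne_zero (pow_ne_zero _ (param5_ne_zero a b))
    (mul_ne_zero (pow_ne_zero _ (param3_ne_zero a b)) fun h0 => ?_)
  rw [h0, natDegree_zero] at h12
  omega

theorem rational_plane56 (a b : ℂ) :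
    IsRationalCurve (plane56 a b) ∧ HasGenus (plane56 a b) 0 := by
  obtain ⟨hm, hd⟩ := monic_natDegree_of_eq (n := 4)
    (F := curve56 (C (C a)) (C (C b)) (C X) X)
    (G := C (6 * C a * X + 2 * C b ^ 2) * X ^ 4 +
      C (14 * C a ^ 2 * X ^ 2 + 8 * C b ^ 2 * C a * X + C b ^ 4) * X ^ 3 +
      C ((6 * C b + 16 * C a ^ 3) * X ^ 3 + 10 * C a ^ 2 * C b ^ 2 * X ^ 2 +
        2 * C b ^ 4 * C a * X) * X ^ 2 +
      C ((16 * C b * C a + 9 * C a ^ 4) * X ^ 4 +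
        (14 * C b ^ 3 + 4 * C a ^ 3 * C b ^ 2) * X ^ 3) * X +
      C (-X ^ 6 + (10 * C b * C a ^ 2 + 2 * C a ^ 5) * X ^ 5 + 20 * C b ^ 3 * C a * X ^ 4 +
        8 * C b ^ 5 * X ^ 3))
    (by simp only [curve56, map_add, map_neg, map_mul, map_pow, map_ofNat]; ring)
    (by compute_degree)
  have hf : bivariate (curve56 (C (C a)) (C (C b)) (C X) X) = plane56 a b := by
    rw [map_curve56, bivariate_CC, bivariate_CC, bivariate_CX, bivariate_X, plane56]
  have hnum : MvPolynomial.aeval ![param5 a b, param6 a b] (numer56 (MvPolynomial.C a)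
      (MvPolynomial.C b) (MvPolynomial.X 0)
      (MvPolynomial.X 1 + MvPolynomial.C a * MvPolynomial.X 0)) =
      numer56 (C a) (C b) (param5 a b) (param6 a b + C a * param5 a b) := by
    simp only [numer56, map_add, map_sub, map_mul, map_pow, map_ofNat, MvPolynomial.aeval_X,
      MvPolynomial.aeval_C, Polynomial.algebraMap_eq, Matrix.cons_val_zero, Matrix.cons_val_one]
  have hden : MvPolynomial.aeval ![param5 a b, param6 a b] (denom56 (MvPolynomial.C a)
      (MvPolynomial.C b) (MvPolynomial.X 0)
      (MvPolynomial.X 1 + MvPolynomial.C a * MvPolynomial.X 0)) =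
      denom56 (C a) (C b) (param5 a b) (param6 a b + C a * param5 a b) := by
    simp only [denom56, map_add, map_mul, map_pow, map_ofNat, MvPolynomial.aeval_X,
      MvPolynomial.aeval_C, Polynomial.algebraMap_eq, Matrix.cons_val_zero, Matrix.cons_val_one]
  refine rational_of_parametrization (P := param5 a b) (Q := param6 a b) ?_ ?_ _ _
    (by rw [hden]; exact denom56_ne_zero a b)
    ((congrArg (X * ·) hden).trans ((X_mul_denom56 a b).trans hnum.symm))
  · rw [← hf, Ne, map_eq_zero_iff _ bivariate_injective]
    exact hm.ne_zero
  · rw [← hf]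
    refine ker_parametrization ?_ ?_ hm ?_ ?_
    · rw [natDegree_param5]; norm_num
    · rw [natDegree_param5, natDegree_param6]; norm_num
    · rw [hd, natDegree_param5]
    · rw [hf, plane56, map_curve56, ← curve56_param a b]
      simp [Polynomial.algebraMap_eq]

end Curves

end BirkhoffFive

end

theorem mainTheorem9 :
    -- closed subspaces of a point of the stratum only have the orders 3, 5, 6, 7, …
    (∀ W ∈ BirkhoffFive.stratum 5, ∀ V : Submodule ℂ (LaurentSeries ℂ), V ≤ W →
      BirkhoffFive.MulClosed V → ∀ f ∈ V, ∀ n : ℤ, BirkhoffFive.HasOrder f n →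
        n ∈ BirkhoffFive.closedOrders) ∧
    -- a closed span of members of a canonical basis only uses p_3, p_5, p_6, …; and
    -- the span of p_3, p_5, p_6, …, when closed, is a maximal closed subspace
    (∀ W ∈ BirkhoffFive.stratum 5, ∀ p : ℤ → LaurentSeries ℂ,
      BirkhoffFive.IsCanonicalBasis 5 W p →
      (∀ T ⊆ BirkhoffFive.stratumIndex 5,
        BirkhoffFive.MulClosed (Submodule.span ℂ (p '' T)) → T ⊆ BirkhoffFive.closedOrders) ∧
      (BirkhoffFive.MulClosed (Submodule.span ℂ (p '' BirkhoffFive.closedOrders)) →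
        ∀ V : Submodule ℂ (LaurentSeries ℂ), V ≤ W → BirkhoffFive.MulClosed V →
          Submodule.span ℂ (p '' BirkhoffFive.closedOrders) ≤ V →
          V = Submodule.span ℂ (p '' BirkhoffFive.closedOrders))) ∧
    -- closedness at fixed H^j_k, and the structure constants
    (∀ H : BirkhoffFive.Idx → ℤ → ℂ, H BirkhoffFive.i3 (-4) = 0 →
      (((∃ C : BirkhoffFive.Idx → BirkhoffFive.Idx → (BirkhoffFive.Idx →₀ ℂ), ∀ j k,
            BirkhoffFive.series H j * BirkhoffFive.series H k =
              (C j k).sum fun l c => c • BirkhoffFive.series H l) ∧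
          BirkhoffFive.SqInvariant (Submodule.span ℂ (Set.range (BirkhoffFive.series H)))) ↔
        ((∀ j, ∀ k : ℤ, 1 ≤ k → H j k = 0) ∧
          BirkhoffFive.Constraints (BirkhoffFive.evenPart H))) ∧
      (BirkhoffFive.SqInvariant (Submodule.span ℂ (Set.range (BirkhoffFive.series H))) →
        ∀ C : BirkhoffFive.Idx → BirkhoffFive.Idx → (BirkhoffFive.Idx →₀ ℂ),
          (∀ j k, BirkhoffFive.series H j * BirkhoffFive.series H k =
              (C j k).sum fun l c => c • BirkhoffFive.series H l) →
          ∀ j k l, C j k l = BirkhoffFive.structConst (BirkhoffFive.evenPart H) j k l)) ∧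
    -- the constraints leave H^3_{-2} and H^3_0 free and determine the rest
    (∀ a b : ℂ, ∃! E : BirkhoffFive.Idx → Fin 3 → ℂ,
      BirkhoffFive.Constraints E ∧ E BirkhoffFive.i3 1 = a ∧ E BirkhoffFive.i3 0 = b) ∧
    -- the points of W_5
    (∀ U : Submodule ℂ (LaurentSeries ℂ), U ∈ BirkhoffFive.W5 ↔
      ∃! E : BirkhoffFive.Idx → Fin 3 → ℂ, BirkhoffFive.Constraints E ∧
        U = Submodule.span ℂ (Set.range fun j =>
          BirkhoffFive.polyToLaurent (BirkhoffFive.basisPoly E j))) ∧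
    -- the algebras A_5 and the fibres of Γ_5
    (∀ E : BirkhoffFive.Idx → Fin 3 → ℂ, BirkhoffFive.Constraints E →
      (∃ (A : NonUnitalSubalgebra ℂ (Polynomial ℂ)) (β : Module.Basis BirkhoffFive.Idx ℂ A),
        (∀ j, (β j : Polynomial ℂ) = BirkhoffFive.basisPoly E j) ∧
        ¬ Module.Finite ℂ A ∧
        ∀ j k l, β.repr (β j * β k) l = BirkhoffFive.structConst E j k l) ∧
      RingHom.ker (MvPolynomial.aeval (R := ℂ) (BirkhoffFive.basisPoly E)) =
        BirkhoffFive.fibreIdeal E) ∧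
    -- the plane curves in the ideal of Γ_5
    BirkhoffFive.curve35 (BirkhoffFive.hVar BirkhoffFive.i3 1) (BirkhoffFive.hVar BirkhoffFive.i3 0)
      (BirkhoffFive.pVar BirkhoffFive.i3) (BirkhoffFive.pVar BirkhoffFive.i5) ∈
        BirkhoffFive.gammaIdeal ∧
    BirkhoffFive.curve56 (BirkhoffFive.hVar BirkhoffFive.i3 1) (BirkhoffFive.hVar BirkhoffFive.i3 0)
      (BirkhoffFive.pVar BirkhoffFive.i5) (BirkhoffFive.pVar BirkhoffFive.i6) ∈
        BirkhoffFive.gammaIdeal ∧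
    -- they are rational, of genus zero
    (∀ a b : ℂ, BirkhoffFive.IsRationalCurve (BirkhoffFive.plane35 a b) ∧
      BirkhoffFive.HasGenus (BirkhoffFive.plane35 a b) 0 ∧
      BirkhoffFive.IsRationalCurve (BirkhoffFive.plane56 a b) ∧
      BirkhoffFive.HasGenus (BirkhoffFive.plane56 a b) 0) := by
  open BirkhoffFive in
  exact ⟨fun _ hW _ hVW hV _ hf _ hn => closed_orders hW hVW hV hf hn,
    fun _ hW _ hp => maximality hW hp,
    fun _ hH => ⟨closed_series_iff hH, fun hsq _ hC => structConst_of_series hH hsq hC⟩,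
    existsUnique_constraints, mem_W5_iff,
    fun _ hE => ⟨exists_polyAlgebra hE, ker_aeval_basisPoly hE⟩,
    curve35_mem_gammaIdeal, curve56_mem_gammaIdeal,
    fun a b => ⟨(rational_plane35 a b).1, (rational_plane35 a b).2, (rational_plane56 a b).1,
      (rational_plane56 a b).2⟩⟩
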